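/- Work over $\mathbb C$. Let $n\ge 1$ and let $p_1,\dots,p_s\in\mathbb P^n$. For integers $d\ge 0$ and $m_1,\dots,m_s\ge 0$ let $\mathcal L=\mathcal L_{n,d}(m_1,\dots,m_s)$ be the linear system of hypersurfaces of degree $d$ in $\mathbb P^n$ having multiplicity at least $m_i$ at $p_i$ for every $i$. Consider the conditions $$(\ast)\qquad m_i\le d\ \text{ for all } i\quad\text{and}\quad \sum_{i=1}^s m_i\le nd .$$ 1. If $(\ast)$ holds, then $\mathcal L$ is non-empty (for every choice of the points, in particular for general points). 2. Suppose that $s\le n+2$ and that the points are in linearly general position, i.e. any at most $n+1$ of them are projectively independent. Then $\mathcal L$ is non-empty if and only if $(\ast)$ holds. 3. Suppose moreover that $n\ge 2$, and let $X$ be the blow-up of $\mathbb P^n$ at $p_1,\dots,p_s$, with exceptional divisors $E_1,\dots,E_s$ and with $H$ the pull-back of the hyperplane class. Then $H,E_1,\dots,E_s$ is a basis of $\mathrm{Pic}(X)\otimes\mathbb R$; write its elements as $dH-\sum_i m_iE_i$ with $d,m_i\in\mathbb R$, and let $\mathrm{Eff}(X)$ be the convex cone generated by the classes of effective divisors. A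 class $dH-\sum_i m_iE_i$ with all $m_i\ge 0$ lies in $\mathrm{Eff}(X)$ if and only if $(\ast)$ holds. If $s\ge 1$, the facets (faces of codimension one) of $\mathrm{Eff}(X)$ that contain a class with all $m_i>0$ are exactly the intersections of $\mathrm{Eff}(X)$ with the hyperplanes $$\{d=m_1\},\dots,\{d=m_s\}\quad\text{if } s\le n,$$ $$\{d=m_1\},\dots,\{d=m_s\},\ \Bigl\{nd=\sum_{i=1}^s m_i\Bigr\}\quad\text{if } s=n+1 \text{ or } s=n+2 .$$ -/

import Mathlib

open scoped LinearAlgebra.Projectivization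

noncomputable section

namespace FatPoints

/-- Complex projective `n`-space, as the space of lines in `ℂ^(n+1)`. -/
abbrev PSpace (n : ℕ) : Type := ℙ ℂ (Fin (n + 1) → ℂ)

/-- The homogeneous coordinate ring `ℂ[x₀, …, xₙ]` of projective `n`-space. -/
abbrev CoordRing (n : ℕ) : Type := MvPolynomial (Fin (n + 1)) ℂ

/-- The homogeneous ideal of a point: the polynomials vanishing on the corresponding line. -/
def pointIdeal {n : ℕ} (p : PSpace n) : Ideal (CoordRing n) :=
  MvPolynomial.vanishingIdeal ℂ (p.submodule : Set (Fin (n + 1) → ℂ))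

/-- The forms of degree `d` that have multiplicity at least `m i` at each point `p i`
(that is, that lie in the `m i`-th power of the homogeneous ideal of `p i`). -/
def fatPointForms {n s : ℕ} (p : Fin s → PSpace n) (d : ℕ) (m : Fin s → ℕ) :
    Submodule ℂ (CoordRing n) :=
  MvPolynomial.homogeneousSubmodule (Fin (n + 1)) ℂ d ⊓
    ⨅ i, (pointIdeal (p i) ^ m i).restrictScalars ℂ

/-- The linear system `L_{n,d}(m₁, …, mₛ)` of hypersurfaces of degree `d` having multiplicity
at least `mᵢ` at `pᵢ`: nonzero forms up to nonzero scalars. -/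
abbrev LinearSystem {n s : ℕ} (p : Fin s → PSpace n) (d : ℕ) (m : Fin s → ℕ) : Type :=
  ℙ ℂ (fatPointForms p d m)

/-- Linearly general position: any at most `n + 1` of the points are projectively independent. -/
def InGeneralPosition {n s : ℕ} (p : Fin s → PSpace n) : Prop :=
  ∀ T : Finset (Fin s), T.card ≤ n + 1 →
    Projectivization.Independent (fun i : T => p i)

/-! ### Divisors on the blow-up of `ℙⁿ` at the points `p₁, …, pₛ` (distinct, `n ≥ 2`) -/

/-- Irreducible hypersurfaces of projective `n`-space, given by their homogeneous ideals. -/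
def Hypersurface (n : ℕ) : Type :=
  {P : Ideal (CoordRing n) // ∃ (F : CoordRing n) (d : ℕ),
    F.IsHomogeneous d ∧ Irreducible F ∧ P = Ideal.span {F}}

/-- The prime divisors on the blow-up at `s` points: the strict transforms of the irreducible
hypersurfaces, and the exceptional divisors `E₁, …, Eₛ`. -/
abbrev PrimeDivisor (n s : ℕ) : Type := Hypersurface n ⊕ Fin s

/-- The homogeneous ideal of the image in `ℙⁿ` of a prime divisor of the blow-up. -/
def center {n s : ℕ} (p : Fin s → PSpace n) : PrimeDivisor n s → Ideal (CoordRing n)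
  | Sum.inl P => P.1
  | Sum.inr i => pointIdeal (p i)

/-- The order of vanishing, along a prime divisor `E` of the blow-up, of the pull-back of a
nonzero form `G`. Along a strict transform it is the exponent of the hypersurface in `G`, and
along the exceptional divisor `Eᵢ` it is the multiplicity of `G` at `pᵢ`. -/
def ordAlong {n s : ℕ} (p : Fin s → PSpace n) (E : PrimeDivisor n s) (G : CoordRing n) : ℕ :=
  sSup {k : ℕ | G ∈ center p E ^ k}

/-- Divisors with real coefficients on the blow-up. -/
abbrev RDivisor (n s : ℕ) : Type := PrimeDivisor n s →₀ ℝ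

/-- `D` is the divisor of a nonzero rational function `G / G'`, with `G` and `G'` forms of the
same degree. -/
def IsPrincipal {n s : ℕ} (p : Fin s → PSpace n) (D : RDivisor n s) : Prop :=
  ∃ (d : ℕ) (G G' : CoordRing n), G.IsHomogeneous d ∧ G'.IsHomogeneous d ∧ G ≠ 0 ∧ G' ≠ 0 ∧
    ∀ E, D E = (ordAlong p E G : ℝ) - (ordAlong p E G' : ℝ)

/-- The divisor class group of the blow-up (which is its Picard group) with real coefficients:
divisors modulo linear equivalence. -/
abbrev RPic {n s : ℕ} (p : Fin s → PSpace n) : Type :=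
  RDivisor n s ⧸ Submodule.span ℝ {D : RDivisor n s | IsPrincipal p D}

/-- The class of a prime divisor. -/
def primeClass {n s : ℕ} (p : Fin s → PSpace n) (E : PrimeDivisor n s) : RPic p :=
  Submodule.Quotient.mk (Finsupp.single E 1)

/-- The hyperplane `x₀ = 0`. -/
def hyperplane (n : ℕ) : Hypersurface n :=
  ⟨Ideal.span {MvPolynomial.X 0}, MvPolynomial.X 0, 1, MvPolynomial.isHomogeneous_X ℂ 0,
    (MvPolynomial.X_prime).irreducible, rfl⟩

/-- The class `H` of the pull-back to the blow-up of a hyperplane: the strict transform of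
`x₀ = 0` plus the exceptional divisors over the points lying on it. -/
def hyperplaneClass {n s : ℕ} (p : Fin s → PSpace n) : RPic p :=
  primeClass p (Sum.inl (hyperplane n)) +
    ∑ i, (ordAlong p (Sum.inr i) (MvPolynomial.X 0) : ℝ) • primeClass p (Sum.inr i)

/-- The class `d H - ∑ mᵢ Eᵢ` with coordinates `(d, m)`. -/
def classOf {n s : ℕ} (p : Fin s → PSpace n) : (ℝ × (Fin s → ℝ)) →ₗ[ℝ] RPic p :=
  (LinearMap.toSpanSingleton ℝ (RPic p) (hyperplaneClass p)).coprod
    (-Fintype.linearCombination ℝ (fun i => primeClass p (Sum.inr i)))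

/-- The effective cone of the blow-up: the convex cone spanned by the classes of prime
(equivalently, of effective) divisors. -/
def effectiveCone {n s : ℕ} (p : Fin s → PSpace n) : PointedCone ℝ (RPic p) :=
  PointedCone.hull ℝ (Set.range (primeClass p))

/-- The effective cone of the blow-up in the coordinates `(d, m) ↔ d H - ∑ mᵢ Eᵢ`. -/
def effectiveConeCoord {n s : ℕ} (p : Fin s → PSpace n) : PointedCone ℝ (ℝ × (Fin s → ℝ)) :=
  (effectiveCone p).comap (classOf p)

/-- A facet of a convex cone: a face of codimension one. -/
def IsFacet {V : Type*} [AddCommGroup V] [Module ℝ V] (F C : PointedCone ℝ V) : Prop :=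
  F.IsFaceOf C ∧
    Module.finrank ℝ (Submodule.span ℝ (F : Set V)) + 1 =
      Module.finrank ℝ (Submodule.span ℝ (C : Set V))

end FatPoints

end

/-! Sufficiency of (∗) is constructive: a product of d hyperplanes, each through at most n of the
points, has the required multiplicities. Peeling off one hyperplane lowers d by one, and a suitable
choice of points on it preserves (∗) (`exists_card_le_and_reduced`, `exists_form_of_sum_le`).

For necessity, `m i ≤ d` is the bound of a multiplicity by the degree. If s ≤ n, the bound on the
sum follows. For n + 1 or n + 2 points in general position, there are rational normal curves of
degree n through all the points and through a generic further point. One of them is not contained in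
the given hypersurface, and counting zeros of the restricted form gives `∑ m i ≤ n * d`
(`sum_multiplicity_le`).

On the blow-up, `mem_pointIdeal_pow_iff` turns multiplicity at a point into divisibility by a power
of a polynomial variable. Orders along all prime divisors are therefore additive, principal divisors
have coordinates zero, and `classOf` is bijective with inverse `picCoord`. Degree and multiplicity
bounds on prime divisors put the effective cone inside (∗). Conversely, the slice d = 1 of (∗) with
nonnegative m has only 0/1 vertices with at most n ones (`one_mem_cone`), and these are represented
by hyperplanes.

The facet statement is then convex geometry: near a class with all m positive the effective cone is
cut out by (∗) alone. A facet through such a class must lie in one of these hyperplanes, since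
otherwise it would contain an interior point; when s ≤ n the sum inequality is implied by the
others. -/

noncomputable section

namespace FatPoints

open MvPolynomial

/-! ### Factors of homogeneous polynomials -/

section Homogeneous

variable {σ R : Type*} [CommRing R]

/-- The substitution `xᵢ ↦ xᵢ T`, which reads off the grading. -/
def gradingHom (σ R : Type*) [CommRing R] :
    MvPolynomial σ R →ₐ[R] Polynomial (MvPolynomial σ R) :=
  aeval fun i => Polynomial.C (X i) * Polynomial.X

theorem gradingHom_of_isHomogeneous {F : MvPolynomial σ R} {d : ℕ} (hF : F.IsHomogeneous d) :
    gradingHom σ R F = Polynomial.monomial d F := by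
  have key : ∀ u ∈ F.support, gradingHom σ R (monomial u (F.coeff u)) =
      Polynomial.monomial d (monomial u (F.coeff u)) := by
    intro u hu
    have hd : u.sum (fun _ e => e) = d := by
      rw [← hF (mem_support_iff.mp hu), Finsupp.weight_apply]
      simp
    rw [gradingHom, aeval_monomial, monomial_eq, ← Polynomial.C_mul_X_pow_eq_monomial]
    simp only [mul_pow, Finsupp.prod_mul, map_mul]
    rw [Finsupp.prod, Finsupp.prod, Finsupp.prod, Finset.prod_pow_eq_pow_sum,
      show ∑ x ∈ u.support, u x = d from hd, map_prod]
    simp only [map_pow, mul_assoc]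
    rfl
  conv_lhs => rw [F.as_sum]
  conv_rhs => rw [F.as_sum]
  rw [map_sum, map_sum]
  exact Finset.sum_congr rfl key

theorem eval_one_gradingHom (F : MvPolynomial σ R) :
    Polynomial.eval 1 (gradingHom σ R F) = F := by
  have : ((Polynomial.aeval (1 : MvPolynomial σ R)).restrictScalars R).comp (gradingHom σ R) =
      AlgHom.id R _ := by
    ext i; simp [gradingHom]
  simpa [Polynomial.coe_aeval_eq_eval] using DFunLike.congr_fun this F

theorem isHomogeneous_of_gradingHom {F : MvPolynomial σ R} {d : ℕ}
    (h : gradingHom σ R F = Polynomial.monomial d F) : F.IsHomogeneous d := by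
  have h2 : gradingHom σ R F = ∑ j ∈ Finset.range (F.totalDegree + 1),
      Polynomial.monomial j (homogeneousComponent j F) := by
    conv_lhs => rw [← sum_homogeneousComponent F]
    rw [map_sum]
    exact Finset.sum_congr rfl fun j _ =>
      gradingHom_of_isHomogeneous (homogeneousComponent_isHomogeneous j F)
  have h3 : F = homogeneousComponent d F := by
    have := congrArg (fun q => Polynomial.coeff q d) (h.symm.trans h2)
    simp only [Polynomial.coeff_monomial, if_true, Polynomial.finsetSum_coeff] at this
    rw [Finset.sum_ite_eq'] at this
    split_ifs at this with hd
    · exact this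
    · have hlt : F.totalDegree < d := by
        rw [Finset.mem_range] at hd
        omega
      rw [homogeneousComponent_eq_zero _ _ hlt]
      exact this
  rw [h3]
  exact homogeneousComponent_isHomogeneous d F

/-- A polynomial is a form exactly when its image under `gradingHom` is a monomial in T. Over a
domain, degree and trailing degree in T are both additive; they agree for the product, hence for
each factor. -/
theorem exists_isHomogeneous_of_mul [IsDomain R] {F G : MvPolynomial σ R} {d : ℕ}
    (hFG : (F * G).IsHomogeneous d) (hF : F ≠ 0) (hG : G ≠ 0) :
    ∃ a b, a + b = d ∧ F.IsHomogeneous a ∧ G.IsHomogeneous b := by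
  have ne : ∀ {A : MvPolynomial σ R}, A ≠ 0 → gradingHom σ R A ≠ 0 := fun {A} hA h0 => hA <| by
    rw [← eval_one_gradingHom A, h0, Polynomial.eval_zero]
  have h := gradingHom_of_isHomogeneous hFG
  rw [map_mul] at h
  have hdeg := congrArg Polynomial.natDegree h
  have htr := congrArg Polynomial.natTrailingDegree h
  rw [Polynomial.natDegree_mul (ne hF) (ne hG),
    Polynomial.natDegree_monomial_eq _ (mul_ne_zero hF hG)] at hdeg
  rw [Polynomial.natTrailingDegree_mul (ne hF) (ne hG),
    Polynomial.natTrailingDegree_monomial (mul_ne_zero hF hG)] at htr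
  have hom : ∀ A : MvPolynomial σ R,
      (gradingHom σ R A).natDegree ≤ (gradingHom σ R A).natTrailingDegree →
      A.IsHomogeneous (gradingHom σ R A).natDegree := by
    intro A hA
    set q := gradingHom σ R A with hq
    have hmon : q = Polynomial.monomial q.natDegree (q.coeff q.natDegree) := by
      ext1 k
      rw [Polynomial.coeff_monomial]
      split_ifs with hk
      · rw [hk]
      · rcases lt_or_gt_of_ne hk with hk | hk
        · exact Polynomial.coeff_eq_zero_of_natDegree_lt hk
        · exact Polynomial.coeff_eq_zero_of_lt_natTrailingDegree (hk.trans_le hA)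
    apply isHomogeneous_of_gradingHom
    have he := eval_one_gradingHom A
    rw [← hq, hmon, Polynomial.eval_monomial, one_pow, mul_one] at he
    rw [← hq]
    conv_lhs => rw [hmon]
    rw [he]
  have h1 := Polynomial.natTrailingDegree_le_natDegree (gradingHom σ R F)
  have h2 := Polynomial.natTrailingDegree_le_natDegree (gradingHom σ R G)
  exact ⟨_, _, hdeg, hom F (by omega), hom G (by omega)⟩

end Homogeneous

theorem natDegree_aeval_le {σ R A : Type*} [CommSemiring R] [CommSemiring A] [Algebra R A]
    (F : MvPolynomial σ R) (f : σ → Polynomial A) {k : ℕ} (hf : ∀ i, (f i).natDegree ≤ k) :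
    (aeval f F).natDegree ≤ F.totalDegree * k := by
  rw [aeval_def, eval₂]
  refine (Polynomial.natDegree_sum_le _ _).trans (Finset.sup_le fun u hu => ?_)
  simp only [Function.comp_apply]
  rw [IsScalarTower.algebraMap_apply R A (Polynomial A),
    Polynomial.algebraMap_eq]
  refine (Polynomial.natDegree_C_mul_le _ _).trans ((Polynomial.natDegree_prod_le _ _).trans ?_)
  refine (Finset.sum_le_sum fun i _ => Polynomial.natDegree_pow_le.trans
    (Nat.mul_le_mul_left _ (hf i))).trans ?_
  rw [← Finset.sum_mul]
  exact Nat.mul_le_mul_right _ (le_totalDegree hu)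

/-! ### Multiplicity at a point -/

section Multiplicity

variable {n : ℕ}

theorem exists_dual_rep_eq_one (p : PSpace n) :
    ∃ f : Module.Dual ℂ (Fin (n + 1) → ℂ), f p.rep = 1 := by
  obtain ⟨f, hf⟩ := Module.Projective.exists_dual_ne_zero ℂ p.rep_nonzero
  exact ⟨(f p.rep)⁻¹ • f, by simp [hf]⟩

/-- The linear form with the values of a linear functional. -/
def linearForm (f : Module.Dual ℂ (Fin (n + 1) → ℂ)) : CoordRing n :=
  ∑ i, C (f (Pi.single i 1)) * X i

theorem eval_linearForm (f : Module.Dual ℂ (Fin (n + 1) → ℂ)) (x : Fin (n + 1) → ℂ) :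
    eval x (linearForm f) = f x := by
  simp only [linearForm, map_sum, map_mul, eval_C, eval_X]
  conv_rhs => rw [pi_eq_sum_univ' x, map_sum]
  refine Finset.sum_congr rfl fun i _ => ?_
  rw [map_smul, smul_eq_mul, mul_comm]

theorem isHomogeneous_linearForm (f : Module.Dual ℂ (Fin (n + 1) → ℂ)) :
    (linearForm f).IsHomogeneous 1 :=
  IsHomogeneous.sum _ _ _ fun i _ => by
    simpa using (isHomogeneous_C _ _).mul (isHomogeneous_X ℂ i)

/-- A linear functional with value one on the chosen representative of a point. -/
def coordAt (p : PSpace n) : Module.Dual ℂ (Fin (n + 1) → ℂ) := (exists_dual_rep_eq_one p).choose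

theorem coordAt_rep (p : PSpace n) : coordAt p p.rep = 1 := (exists_dual_rep_eq_one p).choose_spec

/-- The dilation `x ↦ ℓ(x) v + T (x - ℓ(x) v)` centred at the point `p = [v]`, where `ℓ(v) = 1`. -/
def dilation (p : PSpace n) : CoordRing n →ₐ[ℂ] Polynomial (CoordRing n) :=
  aeval fun i => Polynomial.C (linearForm (coordAt p) * C (p.rep i)) +
    Polynomial.C (X i - linearForm (coordAt p) * C (p.rep i)) * Polynomial.X

theorem mem_pointIdeal_iff {p : PSpace n} {F : CoordRing n} :
    F ∈ pointIdeal p ↔ ∀ c : ℂ, eval (c • p.rep) F = 0 := by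
  rw [pointIdeal, mem_vanishingIdeal_iff, p.submodule_eq]
  simp only [SetLike.mem_coe, Submodule.mem_span_singleton, forall_exists_index,
    forall_apply_eq_imp_iff]
  rfl

theorem eval_one_dilation (p : PSpace n) (F : CoordRing n) :
    Polynomial.eval 1 (dilation p F) = F := by
  have : ((Polynomial.aeval (1 : CoordRing n)).restrictScalars ℂ).comp (dilation p) =
      AlgHom.id ℂ _ := by
    ext i; simp [dilation]
  simpa [Polynomial.coe_aeval_eq_eval] using DFunLike.congr_fun this F

theorem dilation_ne_zero (p : PSpace n) {F : CoordRing n} (hF : F ≠ 0) : dilation p F ≠ 0 :=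
  fun h => hF <| by rw [← eval_one_dilation p F, h, Polynomial.eval_zero]

/-- The dilation takes values in the Rees algebra of the ideal of p: the T-coefficient of each
coordinate's image vanishes on the line of p. -/
theorem coeff_dilation_mem (p : PSpace n) (F : CoordRing n) (j : ℕ) :
    (dilation p F).coeff j ∈ pointIdeal p ^ j := by
  have : dilation p F ∈ (reesAlgebra (pointIdeal p)).restrictScalars ℂ := by
    rw [dilation]
    have hx : ∀ i, Polynomial.C (linearForm (coordAt p) * C (p.rep i)) +
        Polynomial.C (X i - linearForm (coordAt p) * C (p.rep i)) * Polynomial.X ∈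
        (reesAlgebra (pointIdeal p)).restrictScalars ℂ := by
      intro i
      refine add_mem (Subalgebra.algebraMap_mem (reesAlgebra (pointIdeal p)) _) ?_
      show _ ∈ reesAlgebra (pointIdeal p)
      rw [Polynomial.C_mul_X_eq_monomial, reesAlgebra.monomial_mem, pow_one, mem_pointIdeal_iff]
      intro c
      simp [eval_linearForm, coordAt_rep]
    induction F using MvPolynomial.induction_on with
    | C a => rw [aeval_C]; exact Subalgebra.algebraMap_mem _ _
    | add f g hf hg => rw [map_add]; exact add_mem hf hg
    | mul_X f i hf => rw [map_mul, aeval_X]; exact mul_mem hf (hx i)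
  exact (mem_reesAlgebra_iff _ _).mp this j

/-- At T = 0 the dilation projects onto the line of p, so T divides the image of every element of
the ideal. Conversely T = 1 recovers F as the sum of its coefficients, the j-th of which lies in the
j-th power of the ideal. -/
theorem mem_pointIdeal_pow_iff (p : PSpace n) (F : CoordRing n) (k : ℕ) :
    F ∈ pointIdeal p ^ k ↔ Polynomial.X ^ k ∣ dilation p F := by
  constructor
  · intro h
    have hle : pointIdeal p ≤ (Ideal.span {Polynomial.X}).comap (dilation p) := by
      intro G hG
      rw [Ideal.mem_comap, Ideal.mem_span_singleton, Polynomial.X_dvd_iff,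
        Polynomial.coeff_zero_eq_eval_zero]
      refine MvPolynomial.funext fun x => ?_
      rw [mem_pointIdeal_iff] at hG
      rw [map_zero, ← hG (coordAt p x)]
      have : ((aeval x : CoordRing n →ₐ[ℂ] ℂ).comp
          ((Polynomial.aeval (0 : CoordRing n)).restrictScalars ℂ)).comp (dilation p) =
          aeval (coordAt p x • p.rep) := by
        ext i
        simp [dilation, eval_linearForm, aeval_eq_eval]
      simpa [Polynomial.coe_aeval_eq_eval, aeval_eq_eval] using DFunLike.congr_fun this G
    have := Ideal.pow_right_mono hle k h
    have := Ideal.le_comap_pow (dilation p) k this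
    rwa [Ideal.mem_comap, Ideal.span_singleton_pow, Ideal.mem_span_singleton] at this
  · intro h
    rw [← eval_one_dilation p F, Polynomial.eval_eq_sum, Polynomial.sum]
    refine Ideal.sum_mem _ fun j hj => ?_
    rw [one_pow, mul_one]
    have hkj : k ≤ j := by
      by_contra hlt
      exact (Polynomial.mem_support_iff.mp hj) (Polynomial.X_pow_dvd_iff.mp h j (not_le.mp hlt))
    exact Ideal.pow_le_pow_right hkj (coeff_dilation_mem p F j)

theorem natDegree_dilation_le (p : PSpace n) {F : CoordRing n} {d : ℕ} (hF : F.IsHomogeneous d) :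
    (dilation p F).natDegree ≤ d := by
  refine (natDegree_aeval_le F _ (k := 1) fun i => ?_).trans ?_
  · exact (Polynomial.natDegree_C_add (R := CoordRing n)).trans_le
      (Polynomial.natDegree_C_mul_le _ _ |>.trans Polynomial.natDegree_X_le)
  · simpa using hF.totalDegree_le

theorem le_degree_of_mem_pointIdeal_pow {p : PSpace n} {F : CoordRing n} {d k : ℕ}
    (hF : F.IsHomogeneous d) (h0 : F ≠ 0) (h : F ∈ pointIdeal p ^ k) : k ≤ d := by
  have := Polynomial.natDegree_le_of_dvd ((mem_pointIdeal_pow_iff p F k).mp h)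
    (dilation_ne_zero p h0)
  rw [Polynomial.natDegree_X_pow] at this
  exact this.trans (natDegree_dilation_le p hF)

end Multiplicity

end FatPoints

end

noncomputable section

namespace FatPoints

open MvPolynomial

/-! ### Non-emptiness of linear systems -/

section LinearSystems

variable {n s : ℕ}

theorem nonempty_linearSystem_iff {p : Fin s → PSpace n} {d : ℕ} {m : Fin s → ℕ} :
    Nonempty (LinearSystem p d m) ↔
      ∃ F : CoordRing n, F ≠ 0 ∧ F.IsHomogeneous d ∧ ∀ i, F ∈ pointIdeal (p i) ^ m i := by
  have hmem : ∀ F : CoordRing n, F ∈ fatPointForms p d m ↔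
      F.IsHomogeneous d ∧ ∀ i, F ∈ pointIdeal (p i) ^ m i := by
    intro F
    simp [fatPointForms, Submodule.mem_inf, Submodule.mem_iInf]
  constructor
  · rintro ⟨x⟩
    exact ⟨x.rep, by simpa using x.rep_nonzero, (hmem _).mp x.rep.2⟩
  · rintro ⟨F, h0, hF⟩
    exact ⟨Projectivization.mk ℂ ⟨F, (hmem F).mpr hF⟩ (by simpa [Subtype.ext_iff] using h0)⟩

theorem exists_linearForm_mem_pointIdeal (p : Fin s → PSpace n) (T : Finset (Fin s))
    (hT : T.card ≤ n) :
    ∃ L : CoordRing n, L ≠ 0 ∧ L.IsHomogeneous 1 ∧ ∀ i ∈ T, L ∈ pointIdeal (p i) := by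
  have hlt : Submodule.span ℂ ((T.image fun i => (p i).rep : Finset _) : Set (Fin (n + 1) → ℂ))
      < ⊤ := by
    refine Submodule.lt_top_of_finrank_lt_finrank ?_
    refine (finrank_span_finset_le_card _).trans_lt ?_
    rw [Module.finrank_fin_fun]
    exact Nat.lt_succ_of_le (Finset.card_image_le.trans hT)
  obtain ⟨f, hf0, hf⟩ := Submodule.exists_le_ker_of_lt_top _ hlt
  refine ⟨linearForm f, fun h => hf0 ?_, isHomogeneous_linearForm f, fun i hi => ?_⟩
  · refine LinearMap.ext fun x => ?_
    rw [← eval_linearForm, h, map_zero, LinearMap.zero_apply]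
  · rw [mem_pointIdeal_iff]
    intro c
    have : f (p i).rep = 0 := hf (Submodule.subset_span (by
      simpa using ⟨i, hi, rfl⟩))
    rw [eval_linearForm, map_smul, this, smul_zero]

/-- One step of the distribution of multiplicities among hyperplanes: a set of at most `n` points
through which to pass a hyperplane. -/
theorem exists_card_le_and_reduced {d : ℕ} {m : Fin s → ℕ} (hm : ∀ i, m i ≤ d + 1)
    (hsum : ∑ i, m i ≤ n * (d + 1)) :
    ∃ T : Finset (Fin s), T.card ≤ n ∧ (∀ i, m i - (if i ∈ T then 1 else 0) ≤ d) ∧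
      ∑ i, (m i - (if i ∈ T then 1 else 0)) ≤ n * d := by
  classical
  set A := Finset.univ.filter fun i => m i = d + 1 with hA
  set B := Finset.univ.filter fun i => 0 < m i with hB
  have hAB : A ⊆ B := by
    intro i
    simp only [hA, hB, Finset.mem_filter, Finset.mem_univ, true_and]
    omega
  -- Points of multiplicity d + 1 must lie on the new hyperplane; the bound on the sum leaves at
  -- most n of them.
  have hAn : A.card ≤ n := by
    have h1 : A.card * (d + 1) ≤ ∑ i, m i := by
      -- Only the points of maximal multiplicity are counted.
      calc A.card * (d + 1) = ∑ i ∈ A, m i := by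
            rw [Finset.sum_congr rfl fun i hi => (Finset.mem_filter.mp hi).2, Finset.sum_const,
              smul_eq_mul]
        _ ≤ ∑ i, m i := Finset.sum_le_sum_of_subset (Finset.subset_univ _)
    exact Nat.le_of_mul_le_mul_right (h1.trans hsum) d.succ_pos
  obtain ⟨T, hAT, hTB, hT⟩ := Finset.exists_subsuperset_card_eq hAB
    (le_min hAn (Finset.card_le_card hAB)) (min_le_right n B.card)
  have hle : ∀ i, m i - (if i ∈ T then 1 else 0) ≤ d := by
    intro i
    split_ifs with h
    -- Subtracting one suffices here since no multiplicity exceeds d + 1.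
    · have := hm i
      omega
    · have h1 : i ∉ A := fun hi => h (hAT hi)
      have h2 : m i ≠ d + 1 := by simpa [hA] using h1
      have := hm i
      omega
  refine ⟨T, hT ▸ min_le_left _ _, hle, ?_⟩
  -- Either the hyperplane uses n points of positive multiplicity, so the sum drops by n, or at most
  -- n multiplicities are nonzero and each is now at most d.
  rcases le_total n B.card with h | h
  · rw [min_eq_left h] at hT
    have h1 : ∑ i, (m i - (if i ∈ T then 1 else 0)) + ∑ i, (if i ∈ T then 1 else 0) =
        ∑ i, m i := by
      rw [← Finset.sum_add_distrib]
      refine Finset.sum_congr rfl fun i _ => ?_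
      split_ifs with hi
      · have := (Finset.mem_filter.mp (hTB hi)).2
        omega
      · omega
    have h2 : ∑ i, (if i ∈ T then 1 else 0) = n := by simp [hT]
    rw [h2] at h1
    rw [mul_add, mul_one] at hsum
    omega
  · calc ∑ i, (m i - (if i ∈ T then 1 else 0))
        ≤ ∑ i ∈ B, (m i - (if i ∈ T then 1 else 0)) := by
          refine (Finset.sum_subset (Finset.subset_univ B) fun i _ hi => ?_).ge
          have : m i = 0 := by simpa [hB] using hi
          omega
      _ ≤ B.card * d := by
          rw [← smul_eq_mul]
          exact Finset.sum_le_card_nsmul _ _ _ fun i _ => hle i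
      _ ≤ n * d := Nat.mul_le_mul_right _ h

theorem exists_form_of_sum_le (p : Fin s → PSpace n) (d : ℕ) (m : Fin s → ℕ)
    (hm : ∀ i, m i ≤ d) (hsum : ∑ i, m i ≤ n * d) :
    ∃ F : CoordRing n, F ≠ 0 ∧ F.IsHomogeneous d ∧ ∀ i, F ∈ pointIdeal (p i) ^ m i := by
  classical
  induction d generalizing m with
  | zero =>
    refine ⟨1, one_ne_zero, isHomogeneous_one _ _, fun i => ?_⟩
    rw [Nat.le_zero.mp (hm i), pow_zero]
    simp
  | succ d ih =>
    obtain ⟨T, hT, hm', hsum'⟩ := exists_card_le_and_reduced hm hsum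
    obtain ⟨F, hF0, hF, hFp⟩ := ih _ hm' hsum'
    obtain ⟨L, hL0, hL, hLp⟩ := exists_linearForm_mem_pointIdeal p T hT
    refine ⟨F * L, mul_ne_zero hF0 hL0, hF.mul hL, fun i => ?_⟩
    have h := hFp i
    split_ifs at h with hi
    · refine Ideal.pow_le_pow_right (show m i ≤ m i - 1 + 1 by omega) ?_
      rw [pow_succ]
      exact Ideal.mul_mem_mul h (hLp i hi)
    · exact Ideal.mul_mem_right _ _ (by simpa using h)

end LinearSystems

/-! ### Restriction to rational normal curves -/

section RationalNormalCurve

theorem X_sub_C_pow_dvd_aeval {K σ : Type*} [Field K] {V : Set (σ → K)} {F : MvPolynomial σ K}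
    {k : ℕ} (hF : F ∈ vanishingIdeal K V ^ k) {γ : σ → Polynomial K} {b : K}
    (hb : (fun i => (γ i).eval b) ∈ V) :
    (Polynomial.X - Polynomial.C b) ^ k ∣ aeval γ F := by
  have hle : vanishingIdeal K V ≤
      (Ideal.span {Polynomial.X - Polynomial.C b}).comap (aeval γ : MvPolynomial σ K →ₐ[K] _) := by
    intro G hG
    rw [Ideal.mem_comap, Ideal.mem_span_singleton, Polynomial.dvd_iff_isRoot, Polynomial.IsRoot,
      ← (mem_vanishingIdeal_iff.mp hG) _ hb, ← Polynomial.coe_aeval_eq_eval]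
    have : (Polynomial.aeval b).comp (aeval γ) =
        (aeval fun i => (γ i).eval b : MvPolynomial σ K →ₐ[K] K) := by
      ext i
      simp [Polynomial.coe_aeval_eq_eval]
    exact DFunLike.congr_fun this G
  have := Ideal.le_comap_pow _ k (Ideal.pow_right_mono hle k hF)
  rwa [Ideal.mem_comap, Ideal.span_singleton_pow, Ideal.mem_span_singleton] at this

/-- All the conditions are nonvanishing conditions on polynomials in u, none of them zero, so over
an infinite field they hold simultaneously. The pull-back of F is nonzero because v spans. -/
theorem exists_generic_parameters {K ι σ : Type*} [Field K] [Infinite K] [Fintype ι]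
    {F : MvPolynomial σ K} (hF : F ≠ 0) {v : ι → σ → K}
    (hv : ⊤ ≤ Submodule.span K (Set.range v)) :
    ∃ u : ι → K, eval (∑ i, (1 - u i) • v i) F ≠ 0 ∧ (∀ i, u i ≠ 0) ∧ (∀ i, u i ≠ 1) ∧
      Function.Injective u := by
  classical
  set G : MvPolynomial ι K := aeval (fun k => ∑ i, (1 - X i) * C (v i k)) F with hG
  have hGe : ∀ u, eval u G = eval (∑ i, (1 - u i) • v i) F := by
    intro u
    have : (aeval u : MvPolynomial ι K →ₐ[K] K).comp
        (aeval (fun k => ∑ i, (1 - X i) * C (v i k))) =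
        aeval (∑ i, (1 - u i) • v i) := by
      ext k
      simp [aeval_eq_eval]
    exact DFunLike.congr_fun this F
  have hG0 : G ≠ 0 := by
    intro h0
    refine hF (MvPolynomial.funext fun x => ?_)
    obtain ⟨c, hc⟩ := (Submodule.mem_span_range_iff_exists_fun K).mp (hv (Submodule.mem_top (x := x)))
    have := hGe fun i => 1 - c i
    simp only [sub_sub_cancel, hc, h0, map_zero] at this
    rw [← this, map_zero]
  have hX1 : ∀ i : ι, (X i - 1 : MvPolynomial ι K) ≠ 0 := fun i h => by
    have := congrArg (eval 0) h
    simp at this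
  have hXX : ∀ i j : ι, i ≠ j → (X i - X j : MvPolynomial ι K) ≠ 0 := fun i j hij h =>
    hij (X_injective (sub_eq_zero.mp h))
  have hprod : G * ((∏ i, X i) * (∏ i, (X i - 1)) *
      ∏ z ∈ (Finset.univ : Finset ι).offDiag, (X z.1 - X z.2)) ≠ 0 := by
    refine mul_ne_zero hG0 (mul_ne_zero (mul_ne_zero ?_ ?_) ?_)
    · exact Finset.prod_ne_zero_iff.mpr fun i _ => X_ne_zero i
    · exact Finset.prod_ne_zero_iff.mpr fun i _ => hX1 i
    · exact Finset.prod_ne_zero_iff.mpr fun z hz => hXX _ _ (Finset.mem_offDiag.mp hz).2.2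
  obtain ⟨u, hu⟩ : ∃ u, eval u (G * ((∏ i, X i) * (∏ i, (X i - 1)) *
      ∏ z ∈ (Finset.univ : Finset ι).offDiag, (X z.1 - X z.2))) ≠ 0 := by
    by_contra! h
    exact hprod (MvPolynomial.funext fun x => by rw [h, map_zero])
  simp only [map_mul, map_prod, map_sub, map_one, eval_X, mul_ne_zero_iff,
    Finset.prod_ne_zero_iff, Finset.mem_univ, true_imp_iff, Finset.mem_offDiag, true_and,
    sub_ne_zero] at hu
  obtain ⟨h1, ⟨h2, h3⟩, h4⟩ := hu
  exact ⟨u, hGe u ▸ h1, h2, h3, fun i j hij => by_contra fun hne => h4 (i, j) hne hij⟩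

/-- Multiplicities of a form of degree `d` at the coordinate points of a basis and at the sum of
the basis vectors: bounded by intersection with a rational normal curve. -/
theorem sum_multiplicity_le {K : Type*} [Field K] [Infinite K] {n d m' : ℕ}
    {F : MvPolynomial (Fin (n + 1)) K} (hF0 : F ≠ 0) (hF : F.IsHomogeneous d)
    {v : Fin (n + 1) → Fin (n + 1) → K} (hv : LinearIndependent K v) {m : Fin (n + 1) → ℕ}
    (hm : ∀ i, F ∈ vanishingIdeal K (Submodule.span K {v i} : Set (Fin (n + 1) → K)) ^ m i)
    (hm' : F ∈ vanishingIdeal K (Submodule.span K {∑ i, v i} : Set (Fin (n + 1) → K)) ^ m') :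
    ∑ i, m i + m' ≤ n * d := by
  classical
  obtain ⟨u, hu, hu0, hu1, hinj⟩ := exists_generic_parameters hF0
    (hv.span_eq_top_of_card_eq_finrank (by simp)).ge
  -- The curve has degree at most n. At t = 1 / u i only the i-th term survives, so it meets the
  -- line of `v i`. At t = 1 all coefficients equal `∏ j, (1 - u j)`, giving the line of the sum; at
  -- t = 0 it is the generic point off F = 0.
  set q : Fin (n + 1) → Polynomial K := fun i => Polynomial.C (1 - u i) *
    ∏ j ∈ Finset.univ.erase i, (1 - Polynomial.C (u j) * Polynomial.X) with hq
  set γ : Fin (n + 1) → Polynomial K := fun k => ∑ i, q i * Polynomial.C (v i k) with hγ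
  have hγe : ∀ t, (fun k => (γ k).eval t) = ∑ i, (q i).eval t • v i := by
    intro t
    ext k
    simp [hγ, Polynomial.eval_finsetSum]
  have hqe : ∀ i t, (q i).eval t = (1 - u i) * ∏ j ∈ Finset.univ.erase i, (1 - u j * t) := by
    intro i t
    simp [hq, Polynomial.eval_prod]
  set g : Polynomial K := aeval γ F with hg
  have hdeg : g.natDegree ≤ n * d := by
    have hqd : ∀ i, (q i).natDegree ≤ n := by
      intro i
      refine (Polynomial.natDegree_C_mul_le _ _).trans ?_
      refine (Polynomial.natDegree_prod_le _ _).trans ?_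
      refine (Finset.sum_le_card_nsmul _ _ 1 fun j _ => ?_).trans ?_
      · compute_degree
      · simp
    have hγd : ∀ k, (γ k).natDegree ≤ n := fun k =>
      Polynomial.natDegree_sum_le_of_forall_le _ _ fun i _ =>
        (Polynomial.natDegree_mul_C_le _ _).trans (hqd i)
    refine (natDegree_aeval_le F γ hγd).trans ?_
    rw [mul_comm]
    exact Nat.mul_le_mul_left _ hF.totalDegree_le
  have hg0 : g ≠ 0 := by
    intro h
    apply hu
    have h1 : (Polynomial.aeval (0 : K)).comp (aeval γ) =
        (aeval fun i => (γ i).eval 0 : MvPolynomial (Fin (n + 1)) K →ₐ[K] K) := by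
      ext i
      simp [Polynomial.coe_aeval_eq_eval]
    have h2 := DFunLike.congr_fun h1 F
    rw [hγe] at h2
    simp only [hqe, mul_zero, sub_zero, Finset.prod_const_one, mul_one] at h2
    rw [AlgHom.comp_apply, ← hg, h, map_zero] at h2
    exact h2.symm
  have hdvd : ∀ i, (Polynomial.X - Polynomial.C (u i)⁻¹) ^ m i ∣ g := by
    intro i
    refine X_sub_C_pow_dvd_aeval (hm i) ?_
    rw [hγe, SetLike.mem_coe, Submodule.mem_span_singleton]
    refine ⟨(q i).eval (u i)⁻¹, Eq.symm ?_⟩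
    refine Fintype.sum_eq_single i fun j hj => ?_
    rw [hqe, Finset.prod_eq_zero (Finset.mem_erase.mpr ⟨hj.symm, Finset.mem_univ i⟩), mul_zero,
      zero_smul]
    rw [mul_inv_cancel₀ (hu0 i), sub_self]
  have hdvd' : (Polynomial.X - Polynomial.C 1) ^ m' ∣ g := by
    refine X_sub_C_pow_dvd_aeval hm' ?_
    rw [hγe, SetLike.mem_coe, Submodule.mem_span_singleton]
    refine ⟨∏ j, (1 - u j), ?_⟩
    rw [Finset.smul_sum]
    refine Finset.sum_congr rfl fun i _ => ?_
    rw [hqe]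
    simp only [mul_one]
    rw [Finset.mul_prod_erase _ (fun j => 1 - u j) (Finset.mem_univ i)]
  have hall : (∏ i, (Polynomial.X - Polynomial.C (u i)⁻¹) ^ m i) *
      (Polynomial.X - Polynomial.C 1) ^ m' ∣ g := by
    refine IsCoprime.mul_dvd (IsCoprime.prod_left fun i _ => IsCoprime.pow ?_)
      (Finset.prod_dvd_of_coprime (fun i _ j _ hij => IsCoprime.pow ?_) fun i _ => hdvd i) hdvd'
    · refine Polynomial.isCoprime_X_sub_C_of_isUnit_sub (sub_ne_zero.mpr ?_).isUnit
      rw [Ne, inv_eq_one]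
      exact hu1 i
    · exact Polynomial.isCoprime_X_sub_C_of_isUnit_sub
        (sub_ne_zero.mpr fun h => hij (hinj (inv_injective h))).isUnit
  have := Polynomial.natDegree_le_of_dvd hall hg0
  rw [Polynomial.Monic.natDegree_mul
    (Polynomial.monic_prod_of_monic _ _ fun i _ => (Polynomial.monic_X_sub_C _).pow _)
    ((Polynomial.monic_X_sub_C _).pow _), Polynomial.natDegree_prod_of_monic _ _
    fun i _ => (Polynomial.monic_X_sub_C _).pow _] at this
  simp only [Polynomial.natDegree_pow, Polynomial.natDegree_X_sub_C, mul_one] at this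
  exact this.trans hdeg

end RationalNormalCurve

/-! ### Necessity of the sum condition for points in general position -/

section GeneralPosition

variable {n s : ℕ}

theorem InGeneralPosition.linearIndependent {p : Fin s → PSpace n} (hp : InGeneralPosition p)
    {ι : Type*} [Fintype ι] (e : ι ↪ Fin s) (hι : Fintype.card ι ≤ n + 1) :
    LinearIndependent ℂ fun i => (p (e i)).rep := by
  have h := Projectivization.independent_iff.mp (hp (Finset.univ.map e) (by simpa using hι))
  exact h.comp (fun i : ι => ⟨e i, by simp⟩) fun i j hij => e.injective (by simpa using hij)

theorem sum_le_of_mem_pointIdeal_pow {p : Fin s → PSpace n} (hs : s ≤ n + 2)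
    (hp : InGeneralPosition p) {d : ℕ} {m : Fin s → ℕ} {F : CoordRing n} (hF0 : F ≠ 0)
    (hF : F.IsHomogeneous d) (hFp : ∀ i, F ∈ pointIdeal (p i) ^ m i) : ∑ i, m i ≤ n * d := by
  have hspan : ∀ i, F ∈ vanishingIdeal ℂ
      (Submodule.span ℂ {(p i).rep} : Set (Fin (n + 1) → ℂ)) ^ m i := by
    intro i
    have := hFp i
    rwa [pointIdeal, (p i).submodule_eq] at this
  rcases Nat.lt_or_ge n s with hns | hns
  · obtain rfl | rfl : s = n + 1 ∨ s = n + 2 := by omega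
    · have hv := hp.linearIndependent (Function.Embedding.refl _) (by simp)
      -- With no further point, multiplicity zero is imposed at the sum of the basis vectors.
      simpa using sum_multiplicity_le (m' := 0) hF0 hF hv hspan (by simp)
    · have hv := hp.linearIndependent Fin.castSuccEmb (by simp)
      have htop := hv.span_eq_top_of_card_eq_finrank (by simp)
      obtain ⟨a, ha⟩ := (Submodule.mem_span_range_iff_exists_fun ℂ).mp
        (htop.ge (Submodule.mem_top (x := (p (Fin.last (n + 1))).rep)))
      -- A zero coefficient would be a linear relation among the n + 1 points other than the i-th.
      -- Since none vanishes, rescaling the basis makes the last point the sum of the basis vectors.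
      have ha0 : ∀ i, a i ≠ 0 := by
        intro i hi
        have hw := hp.linearIndependent (Fin.succAboveEmb i.castSucc) (by simp)
        have hsum : ∑ j, (Fin.snoc a (-1) : Fin (n + 2) → ℂ) j • (p j).rep = 0 := by
          rw [Fin.sum_univ_castSucc]
          simp only [Fin.snoc_castSucc, Fin.snoc_last]
          rw [← ha, neg_one_smul]
          exact add_neg_cancel _
        rw [Fin.sum_univ_succAbove _ i.castSucc, Fin.snoc_castSucc, hi, zero_smul, zero_add] at hsum
        obtain ⟨k, hk⟩ := Fin.exists_succAbove_eq (Fin.castSucc_lt_last i).ne'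
        have := Fintype.linearIndependent_iff.mp hw _ hsum k
        rw [hk, Fin.snoc_last] at this
        simp at this
      have hv' := hv.units_smul fun i => Units.mk0 (a i) (ha0 i)
      rw [Fin.sum_univ_castSucc]
      refine sum_multiplicity_le hF0 hF hv' (fun i => ?_) ?_
      · have := hspan i.castSucc
        rwa [← Submodule.span_singleton_smul_eq (Units.mk0 (a i) (ha0 i)).isUnit] at this
      · have := hspan (Fin.last _)
        rw [← ha] at this
        exact this
  · calc ∑ i, m i ≤ ∑ _i : Fin s, d :=
          Finset.sum_le_sum fun i _ => le_degree_of_mem_pointIdeal_pow hF hF0 (hFp i)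
      _ = s * d := by simp
      _ ≤ n * d := Nat.mul_le_mul_right _ hns

end GeneralPosition

end FatPoints

end

noncomputable section

namespace FatPoints

open MvPolynomial

/-! ### Orders of vanishing along prime divisors -/

section Order

variable {n s : ℕ}

/-- A homogeneous equation of an irreducible hypersurface. -/
def Hypersurface.form (P : Hypersurface n) : CoordRing n := P.2.choose

theorem Hypersurface.isHomogeneous_form (P : Hypersurface n) :
    P.form.IsHomogeneous P.form.totalDegree := by
  obtain ⟨d, hd, hirr, -⟩ := P.2.choose_spec
  have : P.form.totalDegree = d := hd.totalDegree hirr.ne_zero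
  rw [this]
  exact hd

theorem Hypersurface.irreducible_form (P : Hypersurface n) : Irreducible P.form := by
  obtain ⟨d, -, hirr, -⟩ := P.2.choose_spec
  exact hirr

theorem Hypersurface.eq_span_form (P : Hypersurface n) : P.1 = Ideal.span {P.form} := by
  obtain ⟨d, -, -, h⟩ := P.2.choose_spec
  exact h

/-- Powers of the centre of a prime divisor are described by divisibility by powers of a prime
element in a polynomial ring. -/
theorem exists_prime_pow_dvd_iff (p : Fin s → PSpace n) (E : PrimeDivisor n s) :
    ∃ (θ : CoordRing n →+* Polynomial (CoordRing n)) (π : Polynomial (CoordRing n)),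
      Prime π ∧ Function.Injective θ ∧ ∀ G k, G ∈ center p E ^ k ↔ π ^ k ∣ θ G := by
  rcases E with P | i
  · refine ⟨Polynomial.C, Polynomial.C P.form,
      Polynomial.prime_C_iff.mpr P.irreducible_form.prime, Polynomial.C_injective, fun G k => ?_⟩
    rw [center, P.eq_span_form, Ideal.span_singleton_pow, Ideal.mem_span_singleton,
      ← Polynomial.C_pow, Polynomial.C_dvd_iff_dvd_coeff]
    constructor
    · intro h i
      rw [Polynomial.coeff_C]
      split_ifs
      exacts [h, dvd_zero _]
    · intro h
      simpa using h 0
  · exact ⟨dilation (p i), Polynomial.X, Polynomial.prime_X,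
      (injective_iff_map_eq_zero _).mpr fun F hF =>
        by_contra fun h => dilation_ne_zero (p i) h hF,
      fun G k => mem_pointIdeal_pow_iff (p i) G k⟩

/-- Finiteness matters: the `sSup` of an unbounded set of naturals would be the default value 0. -/
theorem ordAlong_eq_multiplicity {p : Fin s → PSpace n} {E : PrimeDivisor n s}
    {θ : CoordRing n →+* Polynomial (CoordRing n)} {π : Polynomial (CoordRing n)} (hπ : Prime π)
    (hθ : Function.Injective θ) (h : ∀ G k, G ∈ center p E ^ k ↔ π ^ k ∣ θ G)
    {G : CoordRing n} (hG : G ≠ 0) :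
    FiniteMultiplicity π (θ G) ∧ ordAlong p E G = multiplicity π (θ G) := by
  have hfin : FiniteMultiplicity π (θ G) :=
    FiniteMultiplicity.of_not_isUnit hπ.not_isUnit ((map_ne_zero_iff θ hθ).mpr hG)
  refine ⟨hfin, ?_⟩
  rw [ordAlong]
  simp only [h, hfin.pow_dvd_iff_le_multiplicity]
  exact csSup_Iic

theorem le_ordAlong_iff (p : Fin s → PSpace n) (E : PrimeDivisor n s) {G : CoordRing n}
    (hG : G ≠ 0) {k : ℕ} : k ≤ ordAlong p E G ↔ G ∈ center p E ^ k := by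
  obtain ⟨θ, π, hπ, hθ, h⟩ := exists_prime_pow_dvd_iff p E
  obtain ⟨hfin, heq⟩ := ordAlong_eq_multiplicity hπ hθ h hG
  rw [heq, h, hfin.pow_dvd_iff_le_multiplicity]

/-- Additivity comes from primality of π; along an exceptional divisor π is the variable T of the
dilation. -/
theorem ordAlong_mul (p : Fin s → PSpace n) (E : PrimeDivisor n s) {F G : CoordRing n}
    (hF : F ≠ 0) (hG : G ≠ 0) : ordAlong p E (F * G) = ordAlong p E F + ordAlong p E G := by
  obtain ⟨θ, π, hπ, hθ, h⟩ := exists_prime_pow_dvd_iff p E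
  have hFG := ordAlong_eq_multiplicity hπ hθ h (mul_ne_zero hF hG)
  rw [hFG.2, (ordAlong_eq_multiplicity hπ hθ h hF).2, (ordAlong_eq_multiplicity hπ hθ h hG).2]
  rw [map_mul] at hFG ⊢
  exact multiplicity_mul hπ hFG.1

theorem ordAlong_of_isUnit (p : Fin s → PSpace n) (E : PrimeDivisor n s) {G : CoordRing n}
    (hG : IsUnit G) : ordAlong p E G = 0 := by
  obtain ⟨θ, π, hπ, hθ, h⟩ := exists_prime_pow_dvd_iff p E
  rw [(ordAlong_eq_multiplicity hπ hθ h hG.ne_zero).2]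
  exact multiplicity_eq_zero.mpr fun hd => hπ.not_isUnit (isUnit_of_dvd_unit hd (hG.map θ))

theorem ordAlong_pow (p : Fin s → PSpace n) (E : PrimeDivisor n s) {G : CoordRing n}
    (hG : G ≠ 0) (k : ℕ) : ordAlong p E (G ^ k) = k * ordAlong p E G := by
  induction k with
  | zero => simpa using ordAlong_of_isUnit p E isUnit_one
  | succ k ih => rw [pow_succ, ordAlong_mul p E (pow_ne_zero k hG) hG, ih, Nat.succ_mul]

theorem ordAlong_eq_of_associated (p : Fin s → PSpace n) (E : PrimeDivisor n s)
    {F G : CoordRing n} (hF : F ≠ 0) (h : Associated F G) : ordAlong p E G = ordAlong p E F := by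
  obtain ⟨u, rfl⟩ := h
  rw [ordAlong_mul p E hF u.isUnit.ne_zero, ordAlong_of_isUnit p E u.isUnit, add_zero]

theorem ordAlong_hypersurface_form (p : Fin s → PSpace n) (P Q : Hypersurface n)
    [Decidable (Q = P)] :
    ordAlong p (Sum.inl P) Q.form = if Q = P then 1 else 0 := by
  have h0 := Q.irreducible_form.ne_zero
  split_ifs with h
  · subst h
    apply le_antisymm
    · by_contra hlt
      have h2 := (le_ordAlong_iff p (Sum.inl Q) h0 (k := 2)).mp (by omega)
      rw [center, Q.eq_span_form, Ideal.span_singleton_pow, Ideal.mem_span_singleton] at h2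
      exact Q.irreducible_form.not_isUnit (isUnit_of_dvd_one
        ((mul_dvd_mul_iff_left h0).mp (by rwa [mul_one, ← pow_two])))
    · rw [le_ordAlong_iff p _ h0, center, pow_one, Q.eq_span_form]
      exact Ideal.mem_span_singleton_self _
  · by_contra hne
    have h1 := (le_ordAlong_iff p (Sum.inl P) h0 (k := 1)).mp (Nat.one_le_iff_ne_zero.mpr hne)
    rw [center, P.eq_span_form, pow_one, Ideal.mem_span_singleton] at h1
    have := P.irreducible_form.associated_of_dvd Q.irreducible_form h1
    exact h (Subtype.ext (by
      rw [Q.eq_span_form, P.eq_span_form, Ideal.span_singleton_eq_span_singleton]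
      exact this.symm))

end Order

/-! ### The class group -/

section ClassGroup

variable {n s : ℕ}

/-- The coordinates `(d, m)` of the class of a prime divisor. -/
def coordOf (p : Fin s → PSpace n) : PrimeDivisor n s → ℝ × (Fin s → ℝ)
  | Sum.inl P => (P.form.totalDegree, fun i => ordAlong p (Sum.inr i) P.form)
  | Sum.inr i => (0, -Pi.single i 1)

/-- The coordinates `(d, m)` of the class of a divisor. -/
def divisorCoord (p : Fin s → PSpace n) : RDivisor n s →ₗ[ℝ] ℝ × (Fin s → ℝ) :=
  Finsupp.linearCombination ℝ (coordOf p)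

@[simp]
theorem divisorCoord_single (p : Fin s → PSpace n) (E : PrimeDivisor n s) (a : ℝ) :
    divisorCoord p (Finsupp.single E a) = a • coordOf p E :=
  Finsupp.linearCombination_single _ _ _

/-- The pull-back to the blow-up of an irreducible hypersurface. -/
def pullback (p : Fin s → PSpace n) (P : Hypersurface n) : RDivisor n s :=
  Finsupp.single (Sum.inl P) 1 +
    ∑ i, (ordAlong p (Sum.inr i) P.form : ℝ) • Finsupp.single (Sum.inr i) 1

theorem pullback_apply (p : Fin s → PSpace n) (P : Hypersurface n) (E : PrimeDivisor n s) :
    pullback p P E = ordAlong p E P.form := by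
  classical
  rcases E with Q | i
  · rw [ordAlong_hypersurface_form]
    simp [pullback, Finsupp.single_apply]
  · simp [pullback, Finsupp.single_apply]

theorem sum_smul_neg_single (c : Fin s → ℝ) :
    ∑ i, c i • ((0, -Pi.single i 1) : ℝ × (Fin s → ℝ)) = (0, -c) := by
  ext j
  · simp [Prod.fst_sum]
  · simp [Prod.snd_sum, Finset.sum_apply, Pi.single_apply]

/-- The multiplicities in the coordinates of the strict transform cancel against the exceptional
divisors added back. -/
theorem divisorCoord_pullback (p : Fin s → PSpace n) (P : Hypersurface n) :
    divisorCoord p (pullback p P) = ((P.form.totalDegree : ℝ), 0) := by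
  simp only [pullback, map_add, map_sum, map_smul, divisorCoord_single, one_smul]
  simp only [coordOf, sum_smul_neg_single]
  simp

/-- Irreducible factors of a form are forms, so the divisor is the sum of their pull-backs; in
particular it has finite support. -/
theorem exists_divisor_of_form (p : Fin s → PSpace n) {G : CoordRing n} (hG : G ≠ 0) {d : ℕ}
    (hd : G.IsHomogeneous d) :
    ∃ D : RDivisor n s, (∀ E, D E = ordAlong p E G) ∧ divisorCoord p D = ((d : ℝ), 0) := by
  induction G using WfDvdMonoid.induction_on_irreducible generalizing d with
  | zero => exact absurd rfl hG
  | unit u hu =>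
    refine ⟨0, fun E => by simp [ordAlong_of_isUnit p E hu], ?_⟩
    have : d = 0 := by
      rw [← hd.totalDegree hG]
      exact (isUnit_iff_totalDegree_of_isReduced.mp hu).2
    rw [this, map_zero, Nat.cast_zero, Prod.mk_zero_zero]
  | mul a i ha hi ih =>
    obtain ⟨k, l, rfl, hk, hl⟩ := exists_isHomogeneous_of_mul hd hi.ne_zero ha
    obtain ⟨D, hD, hDc⟩ := ih ha hl
    set P : Hypersurface n := ⟨Ideal.span {i}, i, k, hk, hi, rfl⟩ with hP
    have hass : Associated i P.form := by
      rw [← Ideal.span_singleton_eq_span_singleton, ← P.eq_span_form]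
    refine ⟨pullback p P + D, fun E => ?_, ?_⟩
    · rw [Finsupp.add_apply, pullback_apply, hD, ordAlong_mul p E hi.ne_zero ha,
        ordAlong_eq_of_associated p E hi.ne_zero hass, Nat.cast_add]
    · have hdeg : P.form.totalDegree = k := by
        obtain ⟨u, hu⟩ := hass
        rw [← hu, totalDegree_mul_of_isDomain hi.ne_zero u.isUnit.ne_zero, hk.totalDegree hi.ne_zero,
          (isUnit_iff_totalDegree_of_isReduced.mp u.isUnit).2, add_zero]
      rw [map_add, divisorCoord_pullback, hDc, hdeg]
      simp

theorem divisorCoord_eq_zero_of_isPrincipal {p : Fin s → PSpace n} {D : RDivisor n s}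
    (hD : IsPrincipal p D) : divisorCoord p D = 0 := by
  obtain ⟨d, G, G', hG, hG', h0, h0', h⟩ := hD
  obtain ⟨A, hA, hAc⟩ := exists_divisor_of_form p h0 hG
  obtain ⟨A', hA', hAc'⟩ := exists_divisor_of_form p h0' hG'
  have : D = A - A' := by
    ext E
    rw [h, Finsupp.sub_apply, hA, hA']
  rw [this, map_sub, hAc, hAc', sub_self]

/-- The coordinates `(d, m)` of a divisor class. -/
def picCoord (p : Fin s → PSpace n) : RPic p →ₗ[ℝ] ℝ × (Fin s → ℝ) :=
  Submodule.liftQ _ (divisorCoord p)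
    (Submodule.span_le.mpr fun _ hD => divisorCoord_eq_zero_of_isPrincipal hD)

@[simp]
theorem picCoord_primeClass (p : Fin s → PSpace n) (E : PrimeDivisor n s) :
    picCoord p (primeClass p E) = coordOf p E := by
  rw [picCoord, primeClass]
  erw [Submodule.liftQ_apply]
  rw [divisorCoord_single, one_smul]

theorem classOf_apply (p : Fin s → PSpace n) (x : ℝ × (Fin s → ℝ)) :
    classOf p x = x.1 • hyperplaneClass p - ∑ i, x.2 i • primeClass p (Sum.inr i) := by
  simp [classOf, Fintype.linearCombination_apply, sub_eq_add_neg]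

theorem associated_form_hyperplane : Associated (X 0) (hyperplane n).form := by
  rw [← Ideal.span_singleton_eq_span_singleton, ← (hyperplane n).eq_span_form]
  rfl

theorem ordAlong_form_hyperplane (p : Fin s → PSpace n) (E : PrimeDivisor n s) :
    ordAlong p E (hyperplane n).form = ordAlong p E (X 0) :=
  ordAlong_eq_of_associated p E (X_ne_zero 0) associated_form_hyperplane

theorem totalDegree_form_hyperplane : (hyperplane n).form.totalDegree = 1 := by
  obtain ⟨u, hu⟩ := associated_form_hyperplane (n := n)
  rw [← hu, totalDegree_mul_of_isDomain (X_ne_zero 0) u.isUnit.ne_zero, totalDegree_X,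
    (isUnit_iff_totalDegree_of_isReduced.mp u.isUnit).2]

theorem mk_pullback (p : Fin s → PSpace n) (P : Hypersurface n) :
    (Submodule.Quotient.mk (pullback p P) : RPic p) = primeClass p (Sum.inl P) +
      ∑ i, (ordAlong p (Sum.inr i) P.form : ℝ) • primeClass p (Sum.inr i) := by
  simp only [pullback, primeClass, ← Submodule.mkQ_apply, map_add, map_sum, map_smul]

theorem hyperplaneClass_eq_mk (p : Fin s → PSpace n) :
    hyperplaneClass p = Submodule.Quotient.mk (pullback p (hyperplane n)) := by
  simp only [mk_pullback, hyperplaneClass, ordAlong_form_hyperplane]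

theorem picCoord_classOf (p : Fin s → PSpace n) (x : ℝ × (Fin s → ℝ)) :
    picCoord p (classOf p x) = x := by
  have hH : picCoord p (hyperplaneClass p) = (1, 0) := by
    rw [hyperplaneClass_eq_mk, picCoord]
    erw [Submodule.liftQ_apply]
    rw [divisorCoord_pullback, totalDegree_form_hyperplane, Nat.cast_one]
  rw [classOf_apply, map_sub, map_smul, hH, map_sum]
  simp only [map_smul, picCoord_primeClass, coordOf, sum_smul_neg_single]
  ext <;> simp

/-- The equation of the hypersurface divided by the matching power of x₀ is a rational function. -/
theorem mk_pullback_eq_smul (p : Fin s → PSpace n) (P : Hypersurface n) :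
    (Submodule.Quotient.mk (pullback p P) : RPic p) =
      (P.form.totalDegree : ℝ) • hyperplaneClass p := by
  rw [hyperplaneClass_eq_mk, ← Submodule.Quotient.mk_smul, Submodule.Quotient.eq]
  refine Submodule.subset_span ⟨P.form.totalDegree, P.form, X 0 ^ P.form.totalDegree,
    P.isHomogeneous_form, ?_, P.irreducible_form.ne_zero, pow_ne_zero _ (X_ne_zero 0), fun E => ?_⟩
  · simpa using (isHomogeneous_X ℂ (0 : Fin (n + 1))).pow P.form.totalDegree
  · rw [Finsupp.sub_apply, Finsupp.smul_apply, pullback_apply, pullback_apply,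
      ordAlong_form_hyperplane, ordAlong_pow p E (X_ne_zero 0), smul_eq_mul, Nat.cast_mul]

theorem classOf_coordOf (p : Fin s → PSpace n) (E : PrimeDivisor n s) :
    classOf p (coordOf p E) = primeClass p E := by
  rcases E with P | i
  · rw [classOf_apply]
    simp only [coordOf]
    rw [← mk_pullback_eq_smul, mk_pullback, add_sub_cancel_right]
  · rw [classOf_apply]
    simp [coordOf, Pi.single_apply]

theorem classOf_bijective (p : Fin s → PSpace n) : Function.Bijective (classOf p) := by
  refine ⟨Function.LeftInverse.injective (picCoord_classOf p), fun y => ?_⟩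
  obtain ⟨D, rfl⟩ := Submodule.Quotient.mk_surjective _ y
  refine ⟨divisorCoord p D, ?_⟩
  have : classOf p ∘ₗ divisorCoord p = Submodule.mkQ _ := by
    ext E
    simp only [LinearMap.comp_apply, Finsupp.lsingle_apply, divisorCoord_single, one_smul,
      classOf_coordOf]
    rfl
  exact DFunLike.congr_fun this D

end ClassGroup

/-! ### The effective cone -/

section EffectiveCone

variable {n s : ℕ}

theorem coordOf_mem_effectiveConeCoord (p : Fin s → PSpace n) (E : PrimeDivisor n s) :
    coordOf p E ∈ effectiveConeCoord p := by
  rw [effectiveConeCoord, PointedCone.mem_comap, classOf_coordOf]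
  exact PointedCone.subset_hull ⟨E, rfl⟩

theorem effectiveConeCoord_le {p : Fin s → PSpace n} {C : PointedCone ℝ (ℝ × (Fin s → ℝ))}
    (h : ∀ E, coordOf p E ∈ C) : effectiveConeCoord p ≤ C := by
  intro x hx
  have hle : effectiveCone p ≤ C.comap (picCoord p) := by
    refine Submodule.span_le.mpr ?_
    rintro _ ⟨E, rfl⟩
    simpa using h E
  have := hle hx
  rw [PointedCone.mem_comap] at this
  exact picCoord_classOf p x ▸ this

theorem divisorCoord_mem_effectiveConeCoord (p : Fin s → PSpace n) {D : RDivisor n s}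
    (hD : 0 ≤ D) : divisorCoord p D ∈ effectiveConeCoord p := by
  rw [divisorCoord, Finsupp.linearCombination_apply]
  exact Submodule.sum_mem _ fun E _ =>
    PointedCone.smul_mem _ (hD E) (coordOf_mem_effectiveConeCoord p E)

/-- Subtracting `m i` times each exceptional divisor from the divisor of F leaves an effective
divisor. -/
theorem mem_effectiveConeCoord_of_form (p : Fin s → PSpace n) {d : ℕ} {m : Fin s → ℕ}
    {F : CoordRing n} (hF0 : F ≠ 0) (hF : F.IsHomogeneous d)
    (hFp : ∀ i, F ∈ pointIdeal (p i) ^ m i) :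
    ((d : ℝ), fun i => (m i : ℝ)) ∈ effectiveConeCoord p := by
  classical
  obtain ⟨D, hD, hDc⟩ := exists_divisor_of_form p hF0 hF
  have hnn : 0 ≤ D - ∑ i, (m i : ℝ) • Finsupp.single (Sum.inr i) 1 := by
    rintro (P | i)
    · simp [hD]
    · have := (le_ordAlong_iff p (Sum.inr i) hF0).mpr (hFp i)
      simpa [hD, Finsupp.single_apply] using this
  have := divisorCoord_mem_effectiveConeCoord p hnn
  rw [map_sub, hDc, map_sum] at this
  simp only [map_smul, divisorCoord_single, one_smul, coordOf, sum_smul_neg_single] at this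
  convert! this using 1
  ext <;> simp

end EffectiveCone

end FatPoints

end

noncomputable section

namespace FatPoints

/-! ### Facets of cones -/

section Facets

variable {V : Type*} [AddCommGroup V] [Module ℝ V]

theorem exists_sub_of_mem_span {F : PointedCone ℝ V} {w : V}
    (hw : w ∈ Submodule.span ℝ (F : Set V)) : ∃ a ∈ F, ∃ b ∈ F, w = a - b := by
  induction hw using Submodule.span_induction with
  | mem x hx => exact ⟨x, hx, 0, zero_mem F, (sub_zero x).symm⟩
  | zero => exact ⟨0, zero_mem F, 0, zero_mem F, (sub_zero 0).symm⟩
  | add x y _ _ hx hy =>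
    obtain ⟨a, ha, b, hb, rfl⟩ := hx
    obtain ⟨a', ha', b', hb', rfl⟩ := hy
    exact ⟨a + a', add_mem ha ha', b + b', add_mem hb hb', by abel⟩
  | smul c x _ hx =>
    obtain ⟨a, ha, b, hb, rfl⟩ := hx
    rcases le_total 0 c with hc | hc
    · exact ⟨c • a, F.smul_mem hc ha, c • b, F.smul_mem hc hb, smul_sub c a b⟩
    · refine ⟨(-c) • b, F.smul_mem (neg_nonneg.mpr hc) hb, (-c) • a,
        F.smul_mem (neg_nonneg.mpr hc) ha, ?_⟩
      rw [smul_sub, neg_smul, neg_smul]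
      abel

theorem le_span_of_forall_exists_add_mem {C : PointedCone ℝ V} {W : Submodule ℝ V} {z : V}
    (h : ∀ v ∈ W, ∃ ε : ℝ, 0 < ε ∧ z + ε • v ∈ C) : W ≤ Submodule.span ℝ (C : Set V) := by
  intro v hv
  obtain ⟨δ, -, hz⟩ := h 0 W.zero_mem
  rw [smul_zero, add_zero] at hz
  obtain ⟨ε, hε, hzv⟩ := h v hv
  have := Submodule.sub_mem _ (Submodule.subset_span (R := ℝ) hzv) (Submodule.subset_span hz)
  rw [add_sub_cancel_left] at this
  exact (Submodule.smul_mem_iff _ hε.ne').mp this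

theorem isFacet_of_eq_inter_ker [FiniteDimensional ℝ V] {F C : PointedCone ℝ V}
    {ℓ : Module.Dual ℝ V} (hℓ0 : ℓ ≠ 0) (hℓ : ∀ x ∈ C, 0 ≤ ℓ x)
    (hC : Submodule.span ℝ (C : Set V) = ⊤) (hF : ∀ x, x ∈ F ↔ x ∈ C ∧ ℓ x = 0) {z : V}
    (hz : ℓ z = 0) (h : ∀ v, ℓ v = 0 → ∃ ε : ℝ, 0 < ε ∧ z + ε • v ∈ C) : IsFacet F C := by
  refine ⟨⟨fun x hx => ((hF x).mp hx).1, fun {x y a} hx hy ha hxy => ?_⟩, ?_⟩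
  · have h1 := ((hF _).mp hxy).2
    rw [map_add, map_smul, smul_eq_mul] at h1
    refine (hF x).mpr ⟨hx, le_antisymm ?_ (hℓ x hx)⟩
    by_contra hlt
    have := mul_pos ha (not_le.mp hlt)
    linarith [hℓ y hy]
  · have hspan : Submodule.span ℝ (F : Set V) = LinearMap.ker ℓ := by
      refine le_antisymm (Submodule.span_le.mpr fun x hx => ((hF x).mp hx).2) ?_
      refine le_span_of_forall_exists_add_mem (z := z) fun v hv => ?_
      obtain ⟨ε, hε, hv'⟩ := h v hv
      refine ⟨ε, hε, (hF _).mpr ⟨hv', ?_⟩⟩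
      rw [map_add, map_smul, hz, LinearMap.mem_ker.mp hv, smul_zero, add_zero]
    rw [hspan, hC, finrank_top]
    exact Module.Dual.finrank_ker_add_one_of_ne_zero hℓ0

/-- By dimension F spans the hyperplane, so a point x of C on it is a - b with a, b in F. Then x + b
lies in F, and the face property puts x in F. -/
theorem IsFacet.eq_inter_ker [FiniteDimensional ℝ V] {F C : PointedCone ℝ V} (hF : IsFacet F C)
    {ℓ : Module.Dual ℝ V} (hℓ0 : ℓ ≠ 0) (hC : Submodule.span ℝ (C : Set V) = ⊤)
    (hFℓ : ∀ x ∈ F, ℓ x = 0) (x : V) : x ∈ F ↔ x ∈ C ∧ ℓ x = 0 := by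
  refine ⟨fun hx => ⟨hF.1.le hx, hFℓ x hx⟩, fun ⟨hxC, hx⟩ => ?_⟩
  have hspan : Submodule.span ℝ (F : Set V) = LinearMap.ker ℓ := by
    refine Submodule.eq_of_le_of_finrank_eq (Submodule.span_le.mpr fun y hy => hFℓ y hy) ?_
    have h1 := hF.2
    rw [hC, finrank_top, ← Module.Dual.finrank_ker_add_one_of_ne_zero hℓ0] at h1
    exact Nat.add_right_cancel h1
  obtain ⟨a, ha, b, hb, rfl⟩ := exists_sub_of_mem_span (F := F) (w := x) (hspan ▸ hx)
  exact hF.1.mem_of_add_mem_left hxC (hF.1.le hb) (by rwa [sub_add_cancel])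

/-- A facet contains no interior point: z lies strictly between two points of C on any line through
it, the face property puts both in F, and F would span as much as C. -/
theorem IsFacet.not_forall_exists_add_mem {F C : PointedCone ℝ V} (hF : IsFacet F C) {z : V}
    (hz : z ∈ F) (h : ∀ v, ∃ ε : ℝ, 0 < ε ∧ z + ε • v ∈ C) : False := by
  have hall : ∀ v, ∃ ε : ℝ, 0 < ε ∧ z + ε • v ∈ F := by
    intro v
    obtain ⟨ε, hε, h1⟩ := h v
    obtain ⟨δ, hδ, h2⟩ := h (-v)
    refine ⟨ε, hε, hF.1.mem_of_smul_add_smul_mem_left h1 h2 hδ hε ?_⟩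
    have : δ • (z + ε • v) + ε • (z + δ • -v) = (δ + ε) • z := by module
    rw [this]
    exact F.smul_mem (by positivity) hz
  have h1 : Submodule.span ℝ (F : Set V) = ⊤ :=
    top_le_iff.mp (le_span_of_forall_exists_add_mem fun v _ => hall v)
  have h2 : Submodule.span ℝ (C : Set V) = ⊤ :=
    top_le_iff.mp (le_span_of_forall_exists_add_mem fun v _ => h v)
  have := hF.2
  rw [h1, h2] at this
  omega

end Facets

/-! ### The cone cut out by `mᵢ ≤ d` and `∑ mᵢ ≤ n d` -/

section Polyhedron

open Filter Topology

variable {n s : ℕ}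

/-- Mass moves from j to i, keeping the sum, until one of the two coordinates becomes 0 or 1. -/
theorem exists_shift {m : Fin s → ℝ} (h0 : ∀ i, 0 ≤ m i) (h1 : ∀ i, m i ≤ 1) {i j : Fin s}
    (hij : i ≠ j) (hi : 0 < m i ∧ m i < 1) (hj : 0 < m j ∧ m j < 1) :
    ∃ t : ℝ, 0 < t ∧ ∃ m' : Fin s → ℝ, m' = m + t • (Pi.single i 1 - Pi.single j 1) ∧
      (∀ k, 0 ≤ m' k) ∧ (∀ k, m' k ≤ 1) ∧ ∑ k, m' k = ∑ k, m k ∧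
      (Finset.univ.filter fun k => 0 < m' k ∧ m' k < 1).card <
        (Finset.univ.filter fun k => 0 < m k ∧ m k < 1).card := by
  classical
  have ht : 0 < min (1 - m i) (m j) := lt_min (by linarith [hi.2]) hj.1
  set t := min (1 - m i) (m j) with htdef
  have ht1 : t ≤ 1 - m i := min_le_left _ _
  have ht2 : t ≤ m j := min_le_right _ _
  refine ⟨t, ht, _, rfl, ?_⟩
  set m' := m + t • ((Pi.single i 1 : Fin s → ℝ) - Pi.single j 1) with hm'
  have hmi : m' i = m i + t := by simp [hm', hij]
  have hmj : m' j = m j - t := by simp [hm', hij.symm, sub_eq_add_neg]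
  have hmk : ∀ k, k ≠ i → k ≠ j → m' k = m k := fun k hki hkj => by simp [hm', hki, hkj]
  have hcases : ∀ k, k = i ∨ k = j ∨ (k ≠ i ∧ k ≠ j) := fun k => by tauto
  refine ⟨fun k => ?_, fun k => ?_, ?_, Finset.card_lt_card ?_⟩
  · rcases hcases k with rfl | rfl | ⟨hki, hkj⟩
    · linarith
    · linarith
    · rw [hmk k hki hkj]; exact h0 k
  · rcases hcases k with rfl | rfl | ⟨hki, hkj⟩
    · linarith
    · linarith [hj.2]
    · rw [hmk k hki hkj]; exact h1 k
  · simp [hm', Finset.sum_add_distrib, ← Finset.mul_sum]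
  · rw [Finset.ssubset_iff_of_subset]
    · simp only [Finset.mem_filter, Finset.mem_univ, true_and]
      rcases min_choice (1 - m i) (m j) with h | h
      · exact ⟨i, hi, fun h' => by rw [hmi, htdef, h] at h'; linarith [h'.2]⟩
      · exact ⟨j, hj, fun h' => by rw [hmj, htdef, h] at h'; linarith [h'.1]⟩
    · intro k
      simp only [Finset.mem_filter, Finset.mem_univ, true_and]
      rcases hcases k with rfl | rfl | ⟨hki, hkj⟩
      · exact fun _ => hi
      · exact fun _ => hj
      · rw [hmk k hki hkj]; exact id

theorem sum_eq_card_of_integral {m : Fin s → ℝ} {A : Finset (Fin s)}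
    (h : ∀ i ∈ A, m i = 0 ∨ m i = 1) :
    ∑ i ∈ A, m i = (A.filter fun i => m i = 1).card := by
  rw [← Finset.sum_boole]
  refine Finset.sum_congr rfl fun i hi => ?_
  rcases h i hi with h | h <;> simp [h]

/-- The points of the unit cube with coordinate sum at most `n` are convex combinations of
vertices of the cube with at most `n` coordinates equal to one. -/
theorem one_mem_cone {C : PointedCone ℝ (ℝ × (Fin s → ℝ))}
    (hC : ∀ T : Finset (Fin s), T.card ≤ n → ((1 : ℝ), fun i => if i ∈ T then (1 : ℝ) else 0) ∈ C)
    {m : Fin s → ℝ} (h0 : ∀ i, 0 ≤ m i) (h1 : ∀ i, m i ≤ 1) (hsum : ∑ i, m i ≤ n) :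
    ((1 : ℝ), m) ∈ C := by
  classical
  induction hk : (Finset.univ.filter fun k => 0 < m k ∧ m k < 1).card using Nat.strong_induction_on
    generalizing m with
  | _ k ih =>
    have hint : ∀ i, ¬ (0 < m i ∧ m i < 1) → m i = 0 ∨ m i = 1 := by
      intro i hi
      rcases (h0 i).eq_or_lt with h | h
      · exact Or.inl h.symm
      · exact Or.inr (le_antisymm (h1 i) (not_lt.mp fun h' => hi ⟨h, h'⟩))
    by_cases hA : ∃ i, 0 < m i ∧ m i < 1
    · obtain ⟨i, hi⟩ := hA
      by_cases hB : ∃ j, i ≠ j ∧ 0 < m j ∧ m j < 1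
      · obtain ⟨j, hij, hj⟩ := hB
        -- Two fractional coordinates: m lies on the segment between the two opposite shifts, which
        -- have fewer fractional coordinates.
        obtain ⟨t, ht, m', hm', a0, a1, asum, acard⟩ := exists_shift h0 h1 hij hi hj
        obtain ⟨t', ht', m'', hm'', b0, b1, bsum, bcard⟩ := exists_shift h0 h1 hij.symm hj hi
        have ha := ih _ (hk ▸ acard) a0 a1 (asum.trans_le hsum) rfl
        have hb := ih _ (hk ▸ bcard) b0 b1 (bsum.trans_le hsum) rfl
        have hpos : 0 < t + t' := add_pos ht ht'
        have hmem := add_mem (C.smul_mem (div_pos ht' hpos).le ha)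
          (C.smul_mem (div_pos ht hpos).le hb)
        convert! hmem using 1
        rw [hm', hm'']
        refine Prod.ext ?_ ?_
        · simp only [Prod.fst_add, Prod.smul_fst, smul_eq_mul]
          field_simp
          ring
        · funext l
          simp only [Prod.snd_add, Prod.smul_snd, Pi.add_apply, Pi.smul_apply, smul_eq_mul,
            Pi.sub_apply]
          field_simp
          ring
      · have hrest : ∀ j ∈ Finset.univ.erase i, m j = 0 ∨ m j = 1 := fun j hj =>
          hint j fun h => hB ⟨j, (Finset.ne_of_mem_erase hj).symm, h⟩
        set T := (Finset.univ.erase i).filter fun j => m j = 1 with hT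
        have hiT : i ∉ T := by simp [hT]
        -- With a single fractional coordinate the number of ones is strictly below n, so both ways
        -- of rounding it are admissible vertices.
        have hcard : T.card + 1 ≤ n := by
          have h2 := sum_eq_card_of_integral hrest
          rw [← Finset.add_sum_erase _ _ (Finset.mem_univ i), h2] at hsum
          have : (T.card : ℝ) < n := by linarith [hi.1]
          exact_mod_cast this
        have ha := hC T (by omega)
        have hb := hC (insert i T) ((Finset.card_insert_le _ _).trans hcard)
        have hmem := add_mem (C.smul_mem (sub_nonneg.mpr (h1 i)) ha) (C.smul_mem (h0 i) hb)
        convert! hmem using 1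
        refine Prod.ext ?_ ?_
        · simp
        · funext l
          simp only [Prod.snd_add, Prod.smul_snd, Pi.add_apply, Pi.smul_apply, smul_eq_mul]
          by_cases hl : l = i
          · subst hl
            simp [hiT]
          · have hl' : l ∈ T ↔ m l = 1 := by simp [hT, hl]
            rcases hrest l (Finset.mem_erase.mpr ⟨hl, Finset.mem_univ l⟩) with h | h <;>
              simp [hl, hl', h]
    · have hall : ∀ i ∈ Finset.univ, m i = 0 ∨ m i = 1 := fun i _ =>
        hint i fun h => hA ⟨i, h⟩
      rw [sum_eq_card_of_integral hall] at hsum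
      convert! hC _ (by exact_mod_cast hsum) using 2
      funext l
      rcases hall l (Finset.mem_univ l) with h | h <;> simp [h]

theorem mem_cone_of_sum_le {C : PointedCone ℝ (ℝ × (Fin s → ℝ))}
    (hC : ∀ T : Finset (Fin s), T.card ≤ n → ((1 : ℝ), fun i => if i ∈ T then (1 : ℝ) else 0) ∈ C)
    {x : ℝ × (Fin s → ℝ)} (hn : 1 ≤ n) (h0 : ∀ i, 0 ≤ x.2 i) (h1 : ∀ i, x.2 i ≤ x.1)
    (hsum : ∑ i, x.2 i ≤ n * x.1) : x ∈ C := by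
  have hn' : (0 : ℝ) < n := by exact_mod_cast hn
  have hx : 0 ≤ x.1 := by
    have := (Finset.sum_nonneg fun i _ => h0 i).trans hsum
    exact nonneg_of_mul_nonneg_right this hn'
  rcases hx.eq_or_lt with hx | hx
  · have : x = 0 := by
      refine Prod.ext hx.symm (funext fun i => le_antisymm ?_ (h0 i))
      exact (h1 i).trans hx.ge
    rw [this]
    exact zero_mem C
  · have hmem : ((1 : ℝ), fun i => x.2 i / x.1) ∈ C := by
      refine one_mem_cone hC (fun i => div_nonneg (h0 i) hx.le)
        (fun i => (div_le_one hx).mpr (h1 i)) ?_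
      rw [← Finset.sum_div, div_le_iff₀ hx]
      exact hsum
    have := C.smul_mem hx.le hmem
    convert! this using 1
    refine Prod.ext (by simp) (funext fun i => ?_)
    simp [mul_div_cancel₀ _ hx.ne']

/-- The functional `d - mᵢ`. -/
def pointFunctional (i : Fin s) : Module.Dual ℝ (ℝ × (Fin s → ℝ)) :=
  LinearMap.fst ℝ _ _ - LinearMap.proj i ∘ₗ LinearMap.snd ℝ ℝ (Fin s → ℝ)

/-- The functional `n d - ∑ mᵢ`. -/
def curveFunctional (n s : ℕ) : Module.Dual ℝ (ℝ × (Fin s → ℝ)) :=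
  (n : ℝ) • LinearMap.fst ℝ _ _ - ∑ i, LinearMap.proj i ∘ₗ LinearMap.snd ℝ ℝ (Fin s → ℝ)

@[simp]
theorem pointFunctional_apply (i : Fin s) (x : ℝ × (Fin s → ℝ)) :
    pointFunctional i x = x.1 - x.2 i := rfl

@[simp]
theorem curveFunctional_apply (x : ℝ × (Fin s → ℝ)) :
    curveFunctional n s x = n * x.1 - ∑ i, x.2 i := by
  simp [curveFunctional]

theorem eventually_pos_add_mul {a : ℝ} (h : 0 < a) (b : ℝ) :
    ∀ᶠ ε in 𝓝[>] (0 : ℝ), 0 < a + ε * b := by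
  have hc : Tendsto (fun ε : ℝ => a + ε * b) (𝓝 0) (𝓝 (a + 0 * b)) :=
    Continuous.tendsto (by fun_prop) 0
  rw [zero_mul, add_zero] at hc
  exact nhdsWithin_le_nhds (hc.eventually (lt_mem_nhds h))

theorem eventually_nonneg_add_mul {a b : ℝ} (h : 0 < a ∨ (0 ≤ a ∧ b = 0)) :
    ∀ᶠ ε in 𝓝[>] (0 : ℝ), 0 ≤ a + ε * b := by
  rcases h with h | ⟨h, rfl⟩
  · exact (eventually_pos_add_mul h b).mono fun _ => le_of_lt
  · simp [h]

variable {C : PointedCone ℝ (ℝ × (Fin s → ℝ))}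

/-- Membership in `C` of small displacements of a point with positive multiplicities. -/
theorem exists_add_smul_mem
    (hge : ∀ x : ℝ × (Fin s → ℝ), (∀ i, 0 ≤ x.2 i) → (∀ i, x.2 i ≤ x.1) →
      ∑ i, x.2 i ≤ n * x.1 → x ∈ C) {z v : ℝ × (Fin s → ℝ)} (hz : ∀ i, 0 < z.2 i)
    (hpt : ∀ i, 0 < pointFunctional i z ∨ (0 ≤ pointFunctional i z ∧ pointFunctional i v = 0))
    (hcv : 0 < curveFunctional n s z ∨
      (0 ≤ curveFunctional n s z ∧ curveFunctional n s v = 0)) :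
    ∃ ε : ℝ, 0 < ε ∧ z + ε • v ∈ C := by
  have e1 : ∀ᶠ ε in 𝓝[>] (0 : ℝ), ∀ i, 0 ≤ z.2 i + ε * v.2 i :=
    eventually_all.mpr fun i => eventually_nonneg_add_mul (Or.inl (hz i))
  have e2 : ∀ᶠ ε in 𝓝[>] (0 : ℝ), ∀ i, 0 ≤ pointFunctional i z + ε * pointFunctional i v :=
    eventually_all.mpr fun i => eventually_nonneg_add_mul (hpt i)
  have e3 := eventually_nonneg_add_mul hcv
  have e4 : ∀ᶠ ε in 𝓝[>] (0 : ℝ), 0 < ε := eventually_mem_nhdsWithin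
  obtain ⟨ε, ⟨⟨h1, h2⟩, h3⟩, h4⟩ := (((e1.and e2).and e3).and e4).exists
  refine ⟨ε, h4, hge _ h1 (fun i => sub_nonneg.mp ?_) (sub_nonneg.mp ?_)⟩
  · rw [← pointFunctional_apply, map_add, map_smul, smul_eq_mul]
    exact h2 i
  · rw [← curveFunctional_apply, map_add, map_smul, smul_eq_mul]
    exact h3

theorem pointFunctional_ne_zero (i : Fin s) : pointFunctional i ≠ 0 := fun h => by
  have := DFunLike.congr_fun h ((1 : ℝ), (0 : Fin s → ℝ))
  simp at this

theorem curveFunctional_ne_zero (hn : 1 ≤ n) : curveFunctional n s ≠ 0 := fun h => by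
  have := DFunLike.congr_fun h ((1 : ℝ), (0 : Fin s → ℝ))
  simp at this
  omega

theorem span_cone_eq_top (hn : 2 ≤ n) (hs : s ≤ n + 2)
    (hge : ∀ x : ℝ × (Fin s → ℝ), (∀ i, 0 ≤ x.2 i) → (∀ i, x.2 i ≤ x.1) →
      ∑ i, x.2 i ≤ n * x.1 → x ∈ C) :
    Submodule.span ℝ (C : Set (ℝ × (Fin s → ℝ))) = ⊤ := by
  -- An interior point: 3 > 1, and 3n > n + 2 ≥ s since n ≥ 2.
  refine top_le_iff.mp (le_span_of_forall_exists_add_mem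
    (z := ((3 : ℝ), fun _ => (1 : ℝ))) fun v _ => ?_)
  refine exists_add_smul_mem hge (fun i => one_pos) (fun i => Or.inl ?_) (Or.inl ?_)
  · norm_num
  · have h1 : (2 : ℝ) ≤ n := by exact_mod_cast hn
    have h2 : (s : ℝ) ≤ n + 2 := by exact_mod_cast hs
    simp
    linarith

/-- The facets through classes with positive multiplicities of a cone which lies in the cone
`mᵢ ≤ d`, `∑ mᵢ ≤ n d` and agrees with it where all `mᵢ` are non-negative. -/
theorem isFacet_and_pos_iff (hn : 2 ≤ n) (hs : s ≤ n + 2) (hs1 : 1 ≤ s)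
    (hle : ∀ x ∈ C, (∀ i, x.2 i ≤ x.1) ∧ ∑ i, x.2 i ≤ n * x.1)
    (hge : ∀ x : ℝ × (Fin s → ℝ), (∀ i, 0 ≤ x.2 i) → (∀ i, x.2 i ≤ x.1) →
      ∑ i, x.2 i ≤ n * x.1 → x ∈ C) (F : PointedCone ℝ (ℝ × (Fin s → ℝ))) :
    (IsFacet F C ∧ ∃ x ∈ F, ∀ i, 0 < x.2 i) ↔
      (∃ i, ∀ x, x ∈ F ↔ x ∈ C ∧ pointFunctional i x = 0) ∨
      (n + 1 ≤ s ∧ ∀ x, x ∈ F ↔ x ∈ C ∧ curveFunctional n s x = 0) := by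
  classical
  have hspan := span_cone_eq_top hn hs hge
  have hpt : ∀ i, ∀ x ∈ C, 0 ≤ pointFunctional i x := fun i x hx =>
    sub_nonneg.mpr ((hle x hx).1 i)
  have hcv : ∀ x ∈ C, 0 ≤ curveFunctional n s x := fun x hx => by
    rw [curveFunctional_apply]
    exact sub_nonneg.mpr (hle x hx).2
  have hn2 : (2 : ℝ) ≤ n := by exact_mod_cast hn
  have hsn : (s : ℝ) ≤ n + 2 := by exact_mod_cast hs
  have hs0 : (1 : ℝ) ≤ s := by exact_mod_cast hs1
  constructor
  · rintro ⟨hF, x, hxF, hx⟩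
    by_contra! hcon
    obtain ⟨hcon1, hcon2⟩ := hcon
    have hp : ∀ i, ∃ y ∈ F, 0 < pointFunctional i y := by
      intro i
      by_contra! h
      obtain ⟨y, hy⟩ := hcon1 i
      have := hF.eq_inter_ker (pointFunctional_ne_zero i) hspan
        (fun w hw => le_antisymm (h w hw) (hpt i w (hF.1.le hw))) y
      tauto
    have hc : n + 1 ≤ s → ∃ y ∈ F, 0 < curveFunctional n s y := by
      intro hns
      by_contra! h
      obtain ⟨y, hy⟩ := hcon2 hns
      have := hF.eq_inter_ker (curveFunctional_ne_zero (by omega)) hspan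
        (fun w hw => le_antisymm (h w hw) (hcv w (hF.1.le hw))) y
      tauto
    choose y hyF hy using hp
    obtain ⟨c, hcF, hcpos⟩ : ∃ c ∈ F, n + 1 ≤ s → 0 < curveFunctional n s c := by
      by_cases hns : n + 1 ≤ s
      · obtain ⟨c, hcF, hc⟩ := hc hns
        exact ⟨c, hcF, fun _ => hc⟩
      · exact ⟨0, zero_mem F, fun h => absurd h hns⟩
    -- All functionals are nonnegative on F, so summing the witnesses makes each required one
    -- positive. A small multiple of w added to x keeps the multiplicities positive and yields an
    -- interior point of C in F.
    have hwF : ∑ i, y i + c ∈ F := add_mem (Submodule.sum_mem _ fun i _ => hyF i) hcF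
    set w := ∑ i, y i + c with hw
    have hwp : ∀ i, 0 < pointFunctional i w := by
      intro i
      rw [hw, map_add, map_sum]
      exact add_pos_of_pos_of_nonneg (Finset.sum_pos' (fun j _ => hpt i _ (hF.1.le (hyF j)))
        ⟨i, Finset.mem_univ i, hy i⟩) (hpt i _ (hF.1.le hcF))
    have hwc : n + 1 ≤ s → 0 < curveFunctional n s w := by
      intro hns
      rw [hw, map_add, map_sum]
      exact add_pos_of_nonneg_of_pos
        (Finset.sum_nonneg fun j _ => hcv _ (hF.1.le (hyF j))) (hcpos hns)
    have e1 : ∀ᶠ ε in 𝓝[>] (0 : ℝ), ∀ i, 0 < x.2 i + ε * w.2 i :=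
      eventually_all.mpr fun i => eventually_pos_add_mul (hx i) _
    have e2 : ∀ᶠ ε in 𝓝[>] (0 : ℝ), 0 < ε := eventually_mem_nhdsWithin
    obtain ⟨ε, h1, hε⟩ := (e1.and e2).exists
    have hzF : x + ε • w ∈ F := add_mem hxF (F.smul_mem hε.le hwF)
    have hzp : ∀ i, 0 < pointFunctional i (x + ε • w) := fun i => by
      rw [map_add, map_smul, smul_eq_mul]
      exact add_pos_of_nonneg_of_pos (hpt i x (hF.1.le hxF)) (mul_pos hε (hwp i))
    have hzc : 0 < curveFunctional n s (x + ε • w) := by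
      by_cases hns : n + 1 ≤ s
      · rw [map_add, map_smul, smul_eq_mul]
        exact add_pos_of_nonneg_of_pos (hcv x (hF.1.le hxF)) (mul_pos hε (hwc hns))
      -- For s ≤ n the strict sum inequality follows from the inequalities `m i < d` and d > 0.
      · have : Nonempty (Fin s) := ⟨⟨0, hs1⟩⟩
        have hlt : ∀ i, (x + ε • w).2 i < (x + ε • w).1 := fun i => sub_pos.mp (hzp i)
        have hpos : 0 < (x + ε • w).1 := (h1 ⟨0, hs1⟩).trans (hlt ⟨0, hs1⟩)
        rw [curveFunctional_apply, sub_pos]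
        calc ∑ i, (x + ε • w).2 i < ∑ _i : Fin s, (x + ε • w).1 :=
              Finset.sum_lt_sum_of_nonempty Finset.univ_nonempty fun i _ => hlt i
          _ = s * (x + ε • w).1 := by
              rw [Finset.sum_const, Finset.card_fin, nsmul_eq_mul]
          _ ≤ n * (x + ε • w).1 := by
              refine mul_le_mul_of_nonneg_right ?_ hpos.le
              exact_mod_cast (by omega : s ≤ n)
    exact hF.not_forall_exists_add_mem hzF fun v =>
      exists_add_smul_mem hge h1 (fun i => Or.inl (hzp i)) (Or.inl hzc)
  · rintro (⟨i, hi⟩ | ⟨hns, hF⟩)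
    -- A relative interior point of the facet d = m i: the sum inequality is strict because 4n - 3 -
    -- s ≥ 3n - 5 > 0.
    · set z : ℝ × (Fin s → ℝ) := (4, Function.update (fun _ => 1) i 4) with hz
      have hz0 : ∀ j, 0 < z.2 j := fun j => by
        by_cases h : j = i
        · subst h; simp [hz]
        · simp [hz, h]
      have hzi : pointFunctional i z = 0 := by simp [hz]
      have hzj : ∀ j, j ≠ i → 0 < pointFunctional j z := fun j h => by
        simp only [pointFunctional_apply, hz, Function.update_of_ne h]
        norm_num
      have hzc : 0 < curveFunctional n s z := by
        have : ∑ j, z.2 j = 4 + (s - 1) := by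
          rw [← Finset.add_sum_erase _ _ (Finset.mem_univ i)]
          congr 1
          · simp [hz]
          · rw [Finset.sum_congr rfl (g := fun _ => (1 : ℝ)) fun j hj => by
              simp [hz, Finset.ne_of_mem_erase hj]]
            rw [Finset.sum_const, Finset.card_erase_of_mem (Finset.mem_univ i), Finset.card_fin,
              nsmul_eq_mul, mul_one, Nat.cast_sub hs1, Nat.cast_one]
        rw [curveFunctional_apply, this]
        simp only [hz]
        linarith
      have hsmall : ∀ v, pointFunctional i v = 0 → ∃ ε : ℝ, 0 < ε ∧ z + ε • v ∈ C := fun v hv => by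
        refine exists_add_smul_mem hge hz0 (fun j => ?_) (Or.inl hzc)
        by_cases h : j = i
        · subst h
          exact Or.inr ⟨hzi.ge, hv⟩
        · exact Or.inl (hzj j h)
      obtain ⟨-, -, hzC⟩ : ∃ ε : ℝ, 0 < ε ∧ z ∈ C := by
        simpa only [smul_zero, add_zero] using hsmall 0 (map_zero _)
      exact ⟨isFacet_of_eq_inter_ker (pointFunctional_ne_zero i) (hpt i) hspan hi hzi hsmall,
        z, (hi z).mpr ⟨hzC, hzi⟩, hz0⟩
    -- Here the sum inequality is an equality, ns = sn, and every `m i < d` because n < s.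
    · set z : ℝ × (Fin s → ℝ) := (s, fun _ => n) with hz
      have hlt : (n : ℝ) < s := by exact_mod_cast hns
      have hz0 : ∀ j, 0 < z.2 j := fun j => by simp only [hz]; linarith
      have hzc : curveFunctional n s z = 0 := by simp [hz, mul_comm]
      have hsmall : ∀ v, curveFunctional n s v = 0 → ∃ ε : ℝ, 0 < ε ∧ z + ε • v ∈ C :=
        fun v hv => exists_add_smul_mem hge hz0 (fun j => Or.inl (by simpa [hz] using hlt))
          (Or.inr ⟨hzc.ge, hv⟩)
      obtain ⟨-, -, hzC⟩ : ∃ ε : ℝ, 0 < ε ∧ z ∈ C := by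
        simpa only [smul_zero, add_zero] using hsmall 0 (map_zero _)
      exact ⟨isFacet_of_eq_inter_ker (curveFunctional_ne_zero (by omega)) hcv hspan hF hzc hsmall,
        z, (hF z).mpr ⟨hzC, hzc⟩, hz0⟩

end Polyhedron

end FatPoints

end

noncomputable section

namespace FatPoints

/-! ### The effective cone compared with the cone cut out by (∗) -/

section Inequalities

variable {n s : ℕ}

/-- Linear inequalities need checking only on prime divisors: hypersurfaces satisfy the bounds for
forms, and exceptional divisors have coordinates (0, -eᵢ). -/
theorem le_of_mem_effectiveConeCoord {p : Fin s → PSpace n} (hs : s ≤ n + 2)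
    (hp : InGeneralPosition p) {x : ℝ × (Fin s → ℝ)} (hx : x ∈ effectiveConeCoord p) :
    (∀ i, x.2 i ≤ x.1) ∧ ∑ i, x.2 i ≤ n * x.1 := by
  have hmem : ∀ (P : Hypersurface n) (i : Fin s),
      P.form ∈ pointIdeal (p i) ^ ordAlong p (Sum.inr i) P.form := fun P i =>
    (le_ordAlong_iff p (Sum.inr i) P.irreducible_form.ne_zero).mp le_rfl
  have nonneg : ∀ ℓ : Module.Dual ℝ (ℝ × (Fin s → ℝ)), (∀ E, 0 ≤ ℓ (coordOf p E)) → 0 ≤ ℓ x :=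
    fun ℓ hℓ => effectiveConeCoord_le (C := (PointedCone.positive ℝ ℝ).comap ℓ) hℓ hx
  refine ⟨fun i => sub_nonneg.mp (nonneg (pointFunctional i) ?_), sub_nonneg.mp ?_⟩
  · rintro (P | j)
    · rw [pointFunctional_apply, sub_nonneg]
      exact Nat.cast_le.mpr (le_degree_of_mem_pointIdeal_pow P.isHomogeneous_form
        P.irreducible_form.ne_zero (hmem P i))
    · rw [pointFunctional_apply]
      by_cases h : i = j
      · subst h
        simp [coordOf]
      · simp [coordOf, h]
  · rw [← curveFunctional_apply]
    refine nonneg _ ?_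
    rintro (P | j)
    · rw [curveFunctional_apply, sub_nonneg]
      simp only [coordOf]
      exact_mod_cast sum_le_of_mem_pointIdeal_pow hs hp P.irreducible_form.ne_zero
        P.isHomogeneous_form (hmem P)
    · rw [curveFunctional_apply]
      simp [coordOf]

theorem mem_effectiveConeCoord_of_sum_le (p : Fin s → PSpace n) (hn : 1 ≤ n)
    {x : ℝ × (Fin s → ℝ)} (h0 : ∀ i, 0 ≤ x.2 i) (h1 : ∀ i, x.2 i ≤ x.1)
    (hsum : ∑ i, x.2 i ≤ n * x.1) : x ∈ effectiveConeCoord p := by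
  refine mem_cone_of_sum_le (fun T hT => ?_) hn h0 h1 hsum
  obtain ⟨L, hL0, hL, hLp⟩ := exists_linearForm_mem_pointIdeal p T hT
  have := mem_effectiveConeCoord_of_form p (m := fun i => if i ∈ T then 1 else 0) hL0 hL
    fun i => by
      split_ifs with h
      · rw [pow_one]
        exact hLp i h
      · simp
  simpa using this

end Inequalities

end FatPoints

end

theorem lemma2p2 (n s : ℕ) (hn : 1 ≤ n) (p : Fin s → FatPoints.PSpace n) :
    (∀ (d : ℕ) (m : Fin s → ℕ), (∀ i, m i ≤ d) → ∑ i, m i ≤ n * d →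
      Nonempty (FatPoints.LinearSystem p d m)) ∧
    (s ≤ n + 2 → FatPoints.InGeneralPosition p →
      (∀ (d : ℕ) (m : Fin s → ℕ),
        Nonempty (FatPoints.LinearSystem p d m) ↔ (∀ i, m i ≤ d) ∧ ∑ i, m i ≤ n * d) ∧
      (2 ≤ n →
        Function.Bijective (FatPoints.classOf p) ∧
        (∀ (d : ℝ) (m : Fin s → ℝ), (∀ i, 0 ≤ m i) →
          ((d, m) ∈ FatPoints.effectiveConeCoord p ↔
            (∀ i, m i ≤ d) ∧ ∑ i, m i ≤ n * d)) ∧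
        (1 ≤ s → ∀ F : PointedCone ℝ (ℝ × (Fin s → ℝ)),
          (FatPoints.IsFacet F (FatPoints.effectiveConeCoord p) ∧ ∃ x ∈ F, ∀ i, 0 < x.2 i) ↔
            (∃ i, (F : Set (ℝ × (Fin s → ℝ))) =
              {x | x ∈ FatPoints.effectiveConeCoord p ∧ x.1 = x.2 i}) ∨
            (n + 1 ≤ s ∧ (F : Set (ℝ × (Fin s → ℝ))) =
              {x | x ∈ FatPoints.effectiveConeCoord p ∧ n * x.1 = ∑ i, x.2 i})))) := by
  have hnonempty : ∀ (d : ℕ) (m : Fin s → ℕ), (∀ i, m i ≤ d) → ∑ i, m i ≤ n * d →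
      Nonempty (FatPoints.LinearSystem p d m) := fun d m hm hsum =>
    FatPoints.nonempty_linearSystem_iff.mpr (FatPoints.exists_form_of_sum_le p d m hm hsum)
  refine ⟨hnonempty, fun hs hp => ⟨fun d m => ⟨fun h => ?_, fun h => hnonempty d m h.1 h.2⟩,
    fun hn2 => ⟨FatPoints.classOf_bijective p, fun d m hm => ⟨fun h => ?_, fun h => ?_⟩,
      fun hs1 F => ?_⟩⟩⟩
  · obtain ⟨G, hG0, hG, hGp⟩ := FatPoints.nonempty_linearSystem_iff.mp h
    exact ⟨fun i => FatPoints.le_degree_of_mem_pointIdeal_pow hG hG0 (hGp i),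
      FatPoints.sum_le_of_mem_pointIdeal_pow hs hp hG0 hG hGp⟩
  · exact FatPoints.le_of_mem_effectiveConeCoord hs hp h
  · exact FatPoints.mem_effectiveConeCoord_of_sum_le p hn hm h.1 h.2
  · rw [FatPoints.isFacet_and_pos_iff hn2 hs hs1
      (fun x hx => FatPoints.le_of_mem_effectiveConeCoord hs hp hx)
      (fun x => FatPoints.mem_effectiveConeCoord_of_sum_le p hn) F]
    simp only [FatPoints.pointFunctional_apply, FatPoints.curveFunctional_apply, sub_eq_zero,
      Set.ext_iff, SetLike.mem_coe, Set.mem_ofPred_eq]
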